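/- **Setting.** Fix a real number $\alpha>0$. For $n\ge 0$ let $\mathbb S_n$ be the set of strict partitions of $n$ (partitions without equal parts), identified with shifted Young diagrams: row $i$ of the diagram of $\lambda$ consists of the boxes $(i,j)$ with $i\le j\le i+\lambda_i-1$. Write $\ell(\lambda)$ for the number of nonzero parts. For $\mu\in\mathbb S_n$, $\lambda\in\mathbb S_{n+1}$ write $\mu\nearrow\lambda$ if $\lambda$ is obtained from $\mu$ by adding one box, and let $\kappa(\mu,\lambda)=2$ if $\mu\nearrow\lambda$ and $\ell(\lambda)=\ell(\mu)$, $\kappa(\mu,\lambda)=1$ if $\mu\nearrow\lambda$ and $\ell(\lambda)=\ell(\mu)+1$, and $\kappa(\mu,\lambda)=0$ otherwise. Let $\mathsf h(\lambda)$ be the number of oriented paths from $\varnothing$ to $\lambda$ in the graded graph on $\bigsqcup_n\mathbb S_n$ with edge multiplicities $\kappa$. Define $$p^\downarrow(\lambda,\mu)=\frac{\mathsf h(\mu)}{\mathsf h(\lambda)}\,\kappa(\mu,\lambda)\quad(\mu\in\mathbb S_n,\ \lambda\in\mathbb S_{n+1}),$$ $$M_n(\lambda)=\frac{\mathsf h(\lambda)^2}{n!}\,2^{\ell(\lambda)-n}\cdot\frac{\prod_{(i,j)\in\lambda}\big((j-i)(j-i+1)+\alpha\big)}{\alpha(\alpha+2)\cdots(\alpha+2n-2)}\quad(\lambda\in\mathbb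 S_n),$$ $$p^\uparrow(\lambda,\nu)=\frac{M_{n+1}(\nu)}{M_n(\lambda)}\,p^\downarrow(\nu,\lambda)\quad(\lambda\in\mathbb S_n,\ \nu\in\mathbb S_{n+1}),$$ and let $T_n$ be the operator on real functions on $\mathbb S_n$ with matrix $T_n(\lambda,\widetilde\lambda)=\sum_{\nu\in\mathbb S_{n+1}}p^\uparrow(\lambda,\nu)\,p^\downarrow(\nu,\widetilde\lambda)$, that is, $(T_ng)(\lambda)=\sum_{\widetilde\lambda\in\mathbb S_n}T_n(\lambda,\widetilde\lambda)g(\widetilde\lambda)$. Let $\Gamma=\mathbb R[p_1,p_3,p_5,\dots]$, graded by $\deg p_{2m-1}=2m-1$. An element $f\in\Gamma$ is viewed as a function of strict partitions through $p_k(\lambda)=\sum_i\lambda_i^k$ ($k$ odd), and $f_n$ denotes its restriction to $\mathbb S_n$. A linear operator $R\colon\Gamma\to\Gamma$ has degree $\le r$ (where $r\in\mathbb Z$) if $\deg(Rf)\le\deg f+r$ for all $f\in\Gamma$, with $\deg 0=-\infty$; it has degree $r$ if $r$ is the least such integer; it is homogeneous of degree $r$ if it maps homogeneous elements of degree $m$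 to homogeneous elements of degree $m+r$ for every $m$ (zero being homogeneous of every degree). **Theorem 5.1.** There exists a unique operator $\widetilde B\colon\Gamma\to\Gamma$ such that $$(T_n-\mathbf 1)f_n=\frac{(\widetilde Bf)_n}{(n+\alpha/2)(n+1)}\qquad\text{for all } n\ge1 \text{ and all } f\in\Gamma.$$ It is linear and is unique even among all maps $\Gamma\to\Gamma$. The operator $\widetilde B$ has degree $0$. There is a unique linear operator $B\colon\Gamma\to\Gamma$ that is homogeneous of degree $0$ and for which $\widetilde B-B$ has degree $\le-1$ (the zero-degree homogeneous component of $\widetilde B$), and it is given by $$B=\sum_{i,j=2}^{\infty}(2i-1)(2j-1)\,(p_1p_{2i+2j-3}-p_{2i-1}p_{2j-1})\frac{\partial^2}{\partial p_{2i-1}\,\partial p_{2j-1}}+2\sum_{i,j=1}^{\infty}(2i+2j-1)\,p_1p_{2i-1}p_{2j-1}\frac{\partial}{\partial p_{2i+2j-1}}-\sum_{i=2}^{\infty}(2i-1)\Big(2i-2+\frac\alpha2\Big)p_{2i-1}\frac{\partial}{\partial p_{2i-1}}.$$ In particular $B$ contains no derivative in $p_1$, and $B$ commutes with multiplication by $p_1$.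 -/

import Mathlib

namespace SchurGraph

/-! ### Strict partitions and shifted Young diagrams -/

/-- `Strict n` is the finite set of all strict partitions of `n`, that is, of partitions of `n`
without equal parts. -/
abbrev Strict (n : ℕ) : Type := {lam : n.Partition // lam ∈ Nat.Partition.distincts n}

/-- The length of a strict partition, that is, the number of its (nonzero) parts. -/
def len {n : ℕ} (lam : Strict n) : ℕ := lam.1.parts.card

/-- The number of the row of the shifted diagram that corresponds to the part `m`:
rows are ordered by decreasing length, and the first row has number `1`. -/
def rowOf {n : ℕ} (lam : Strict n) (m : ℕ) : ℕ := (lam.1.parts.filter (fun k => m ≤ k)).card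

/-- The shifted Young diagram of a strict partition, as the set of its boxes `(i, j)`
(row number, column number). The row with number `i` starts on the diagonal,
at the box `(i, i)`, and has `lam_i` boxes. -/
def diagram {n : ℕ} (lam : Strict n) : Finset (ℕ × ℕ) :=
  lam.1.parts.toFinset.biUnion
    (fun m => (Finset.range m).image (fun c => (rowOf lam m, rowOf lam m + c)))

/-- `nu` is obtained from `lam` by adding one box. -/
def AddsBox {n k : ℕ} (lam : Strict n) (nu : Strict k) : Prop :=
  ∃ b ∈ diagram nu, b ∉ diagram lam ∧ insert b (diagram lam) = diagram nu

instance {n k : ℕ} (lam : Strict n) (nu : Strict k) : Decidable (AddsBox lam nu) := by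
  unfold AddsBox; infer_instance

/-- The multiplicity of the edge between `mu` and `lam` in the Schur graph. -/
def kappa {n : ℕ} (mu : Strict n) (lam : Strict (n + 1)) : ℕ :=
  if AddsBox mu lam ∧ len lam = len mu then 2
  else if AddsBox mu lam ∧ len lam = len mu + 1 then 1
  else 0

/-- The number of oriented paths (counted with edge multiplicities) in the Schur graph from the
empty partition to `lam`: a path to `lam` is a path to some `mu` one floor below,
followed by one of the `kappa mu lam` edges from `mu` to `lam`. -/
def pathCount : (n : ℕ) → Strict n → ℕ
  | 0, _ => 1
  | n + 1, lam => ∑ mu : Strict n, pathCount n mu * kappa mu lam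

/-! ### Multiplicative measures and the up/down Markov chains -/

noncomputable section

/-- The down transition function. -/
def pDown {n : ℕ} (lam : Strict (n + 1)) (mu : Strict n) : ℝ :=
  (pathCount n mu : ℝ) / (pathCount (n + 1) lam : ℝ) * (kappa mu lam : ℝ)

/-- The Plancherel measure on `Strict n`. -/
def plancherel {n : ℕ} (lam : Strict n) : ℝ :=
  (pathCount n lam : ℝ) ^ 2 / (n.factorial : ℝ) * (2 : ℝ) ^ ((len lam : ℤ) - (n : ℤ))

/-- The multiplicative measure with parameter `α` on `Strict n`: the Plancherel measure times the
product of `(j - i) (j - i + 1) + α` over all boxes `(i, j)` of the shifted diagram, divided by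
the normalizing constant `α (α + 2) (α + 4) ⋯ (α + 2 n - 2)`. -/
def multMeasure (α : ℝ) {n : ℕ} (lam : Strict n) : ℝ :=
  plancherel lam * (1 / ∏ k ∈ Finset.range n, (α + 2 * (k : ℝ))) *
    ∏ b ∈ diagram lam, (((b.2 : ℝ) - (b.1 : ℝ)) * ((b.2 : ℝ) - (b.1 : ℝ) + 1) + α)

/-- The up transition function of the system of multiplicative measures with parameter `α`. -/
def pUp (α : ℝ) {n : ℕ} (lam : Strict n) (nu : Strict (n + 1)) : ℝ :=
  multMeasure α nu / multMeasure α lam * pDown nu lam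

/-- The transition matrix of the `n`-th up/down Markov chain. -/
def upDownMatrix (α : ℝ) (n : ℕ) : Matrix (Strict n) (Strict n) ℝ :=
  fun lam lam' => ∑ nu : Strict (n + 1), pUp α lam nu * pDown nu lam'

/-- The one-step transition operator `T_n` of the `n`-th up/down Markov chain, acting on functions
on `Strict n` by `(T_n f)(lam) = ∑ lam', T_n(lam, lam') f(lam')`. -/
def T (α : ℝ) (n : ℕ) : (Strict n → ℝ) →ₗ[ℝ] (Strict n → ℝ) :=
  (upDownMatrix α n).mulVecLin

/-! ### The algebra of doubly symmetric functions -/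

/-- The algebra `Γ = ℝ[p_1, p_3, p_5, …]`; the generator with index `i` is the odd Newton
power sum `p_{2i+1}`. -/
abbrev Gam : Type := MvPolynomial ℕ ℝ

/-- The odd power sum `p_{2i+1}`, as an element of `Γ`. -/
def p (i : ℕ) : Gam := MvPolynomial.X i

/-- The operator `∂ / ∂p_{2i+1}` on `Γ`. -/
def dp (i : ℕ) : Gam →ₗ[ℝ] Gam := (MvPolynomial.pderiv i).toLinearMap

/-- The restriction `f_n` of (the function on strict partitions given by) an element `f` of `Γ`
to `Strict n`: it sends `p_{2i+1}` to the sum of the powers `m ^ (2i+1)` over the parts `m`. -/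
def restrict (n : ℕ) : Gam →ₐ[ℝ] (Strict n → ℝ) :=
  MvPolynomial.aeval
    (fun i (lam : Strict n) => (lam.1.parts.map (fun m : ℕ => (m : ℝ) ^ (2 * i + 1))).sum)

/-- The grading of `Γ`: `deg p_{2i+1} = 2i+1`. -/
def wt (i : ℕ) : ℤ := 2 * (i : ℤ) + 1

/-- The degree of an element of `Γ`, with `deg 0 = ⊥`. -/
def deg (f : Gam) : WithBot ℤ := MvPolynomial.weightedTotalDegree' wt f

/-- The operator `R` has degree `≤ r`, that is, `deg (R f) ≤ deg f + r` for all `f`. -/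
def OpDegreeLE (R : Gam →ₗ[ℝ] Gam) (r : ℤ) : Prop :=
  ∀ f : Gam, deg (R f) ≤ deg f + (r : WithBot ℤ)

/-- The operator `R` has degree (exactly) `r`. -/
def OpHasDegree (R : Gam →ₗ[ℝ] Gam) (r : ℤ) : Prop :=
  IsLeast {s : ℤ | OpDegreeLE R s} r

/-- The operator `R` is homogeneous of degree `r`: it maps homogeneous elements of degree `m`
to homogeneous elements of degree `m + r` (where zero is homogeneous of every degree). -/
def OpHomogeneous (R : Gam →ₗ[ℝ] Gam) (r : ℤ) : Prop :=
  ∀ (m : ℤ) (f : Gam), MvPolynomial.IsWeightedHomogeneous wt f m →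
    MvPolynomial.IsWeightedHomogeneous wt (R f) (m + r)

/-- `S` is a zero-degree homogeneous component of `R`: it is homogeneous of degree zero, and
`R = S + (an operator of degree ≤ -1)`. -/
def IsZeroDegreeComponent (R S : Gam →ₗ[ℝ] Gam) : Prop :=
  OpHomogeneous S 0 ∧ OpDegreeLE (R - S) (-1)

/-! ### The explicit differential operator -/

theorem finite_dp_ne_zero (f : Gam) : {i : ℕ | dp i f ≠ 0}.Finite := by
  refine f.vars.finite_toSet.subset fun i hi => ?_
  by_contra h
  exact hi (MvPolynomial.pderiv_eq_zero_of_notMem_vars h)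

theorem finite_dp_shift_ne_zero (k : ℕ) (f : Gam) : {i : ℕ | dp (i + k) f ≠ 0}.Finite :=
  (finite_dp_ne_zero f).preimage (add_left_injective k).injOn

theorem dp_comm (i j : ℕ) (f : Gam) : dp i (dp j f) = dp j (dp i f) := by
  rcases eq_or_ne i j with rfl | hij
  · rfl
  change MvPolynomial.pderiv i (MvPolynomial.pderiv j f) =
    MvPolynomial.pderiv j (MvPolynomial.pderiv i f)
  induction f using MvPolynomial.induction_on with
  | C a => simp
  | add f g hf hg => simp only [map_add, hf, hg]
  | mul_X f k hf =>
    classical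
    by_cases hi : k = i
    · subst hi
      simp [Derivation.leibniz, MvPolynomial.pderiv_X, hf, hij]
      ring
    · by_cases hj : k = j
      · subst hj
        simp [Derivation.leibniz, MvPolynomial.pderiv_X, hf, hij.symm]
        ring
      · simp [Derivation.leibniz, MvPolynomial.pderiv_X, hf, hi, hj]

/-- The summand with indices `i + 2`, `j + 2` of the second order part. -/
def secondOrderTerm (ij : ℕ × ℕ) : Gam →ₗ[ℝ] Gam :=
  LinearMap.mulLeft ℝ
      (MvPolynomial.C ((2 * (ij.1 : ℝ) + 3) * (2 * (ij.2 : ℝ) + 3)) *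
        (p 0 * p (ij.1 + ij.2 + 2) - p (ij.1 + 1) * p (ij.2 + 1))) ∘ₗ
    dp (ij.1 + 1) ∘ₗ dp (ij.2 + 1)

/-- The summand with indices `i + 1`, `j + 1` of the cubic first order part. -/
def cubicTerm (ij : ℕ × ℕ) : Gam →ₗ[ℝ] Gam :=
  LinearMap.mulLeft ℝ
      (MvPolynomial.C (2 * (ij.1 : ℝ) + 2 * (ij.2 : ℝ) + 3) * (p 0 * p ij.1 * p ij.2)) ∘ₗ
    dp (ij.1 + ij.2 + 1)

/-- The summand with index `i + 2` of the linear first order part. -/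
def linearTerm (α : ℝ) (i : ℕ) : Gam →ₗ[ℝ] Gam :=
  LinearMap.mulLeft ℝ
      (MvPolynomial.C ((2 * (i : ℝ) + 3) * (2 * (i : ℝ) + 2 + α / 2)) * p (i + 1)) ∘ₗ
    dp (i + 1)

theorem secondOrderTerm_finite (f : Gam) :
    (Function.support fun ij => secondOrderTerm ij f).Finite := by
  have h := finite_dp_shift_ne_zero 1 f
  refine (h.prod h).subset fun ij hij => ?_
  have hcomm : dp (ij.1 + 1) (dp (ij.2 + 1) f) = dp (ij.2 + 1) (dp (ij.1 + 1) f) :=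
    dp_comm _ _ f
  refine ⟨fun h1 => hij ?_, fun h2 => hij ?_⟩
  · simp only [secondOrderTerm, LinearMap.comp_apply, hcomm, h1, map_zero]
  · simp only [secondOrderTerm, LinearMap.comp_apply, h2, map_zero]

theorem cubicTerm_finite (f : Gam) : (Function.support fun ij => cubicTerm ij f).Finite := by
  obtain ⟨N, hN⟩ := (finite_dp_ne_zero f).bddAbove
  refine ((Set.finite_Iic N).prod (Set.finite_Iic N)).subset fun ij hij => ?_
  have h : ij.1 + ij.2 + 1 ≤ N := hN fun h => hij (by
    simp only [cubicTerm, LinearMap.comp_apply, h, map_zero])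
  exact ⟨Set.mem_Iic.2 (by omega), Set.mem_Iic.2 (by omega)⟩

theorem linearTerm_finite (α : ℝ) (f : Gam) :
    (Function.support fun i => linearTerm α i f).Finite :=
  (finite_dp_shift_ne_zero 1 f).subset fun i hi h => hi (by
    simp only [linearTerm, LinearMap.comp_apply, h, map_zero])

/-- The pointwise sum of a family of operators of which only finitely many are nonzero
at every given element. -/
def opSum {ι : Type} (t : ι → Gam →ₗ[ℝ] Gam)
    (ht : ∀ f, (Function.support fun i => t i f).Finite) : Gam →ₗ[ℝ] Gam where
  toFun f := ∑ᶠ i, t i f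
  map_add' f g := by
    simp only [map_add]
    exact finsum_add_distrib (ht f) (ht g)
  map_smul' c f := by
    simp only [map_smul, RingHom.id_apply]
    exact (smul_finsum c _).symm

/-- The operator `B` on `Γ`:
`B = ∑_{i,j ≥ 2} (2i-1)(2j-1) (p_1 p_{2i+2j-3} - p_{2i-1} p_{2j-1}) ∂²/∂p_{2i-1}∂p_{2j-1}`
`  + 2 ∑_{i,j ≥ 1} (2i+2j-1) p_1 p_{2i-1} p_{2j-1} ∂/∂p_{2i+2j-1}`
`  - ∑_{i ≥ 2} (2i-1) (2i-2+α/2) p_{2i-1} ∂/∂p_{2i-1}`.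
The summation indices below are shifted so that they start from `0`. -/
def B (α : ℝ) : Gam →ₗ[ℝ] Gam :=
  opSum secondOrderTerm secondOrderTerm_finite
    + (2 : ℝ) • opSum cubicTerm cubicTerm_finite
    - opSum (linearTerm α) (linearTerm_finite α)

/-- The operator `R` on `Γ` satisfies `(T_n - 1) f_n = (R f)_n / ((n + α/2) (n + 1))` for all
`n ≥ 1` and all `f` in `Γ`. -/
def RepresentsUpDown (α : ℝ) (R : Gam → Gam) : Prop :=
  ∀ n : ℕ, 1 ≤ n → ∀ f : Gam,
    T α n (restrict n f) - restrict n f =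
      (1 / (((n : ℝ) + α / 2) * ((n : ℝ) + 1))) • restrict n (R f)

end

end SchurGraph

/-! A strict partition is encoded by its set `S` of parts. A box added to a row of length `m` has
eigenvalue `m (m + 1)`; a box removed from a row of length `k` has eigenvalue `k (k - 1)`. With the
hook formula (`pathCount_eq`), the up and down probabilities become, up to normalization, residues
of `(v + α) / v * ∏ (v - k (k - 1)) / (v - k (k + 1))` and of the reciprocal of the last product;
boxes that cannot be moved have residue zero, since a zero cancels the pole.

Moments of residues are coefficients of an expansion at infinity, whose logarithm involves the sums
of `(k (k + 1)) ^ r - (k (k - 1)) ^ r`. These are odd in `k`, so all moments lie in `Γ`. Moving a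
box of eigenvalue `t` shifts each odd power sum by a polynomial in `t`. Expanding `f` in `t` and
replacing powers of `t` by moments gives operators `U = upOp α` and `D = downOp` on `Γ` (`ev_upOp`,
`ev_downOp`), and `T_n` becomes `U D` divided by `(2 n + α) (n + 1)`. As `n` is the value of `p_1`,
the required operator is `U D / 2 - (p_1 + α / 2) (p_1 + 1)`, named `generator`.

For the degree, `t` counts as two and each derivative paired with its power of `t` costs one. Modulo
degree `-2`, `D = p_1 - E + H / 2 + P` and `U = 2 p_1 + 2 E + α + H + 2 P + α ∂/∂p_1`, with `E`,
`H`, `P` the operators `euler`, `hessian`, `pairing`. In `U D` the terms of positive degree cancel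
against the subtracted polynomial because `[E, p_1] = p_1`, and the part of degree zero is `B`
(`upOp_downOp_sub_mem_Fil`, `B_eq`).

Uniqueness holds because an element of `Γ` vanishing on all nonempty strict partitions is zero
(`eq_zero_of_ev_eq_zero`). The degree is not negative because `B` does not kill `p_3`. -/

namespace SchurGraph

open Finset

noncomputable section

/-! ### Partial fractions -/

/-- The coefficient of `1 / (v - u k)` in the partial fraction expansion of
`∏ j ∈ T, (v - y j) / (v - u j)`. -/
def residue (T : Finset ℕ) (u y : ℕ → ℝ) (k : ℕ) : ℝ :=
  (u k - y k) * ∏ j ∈ T.erase k, (u k - y j) / (u k - u j)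

theorem residue_insert {T : Finset ℕ} {u y : ℕ → ℝ} {a k : ℕ} (ha : a ∉ T) (hk : k ∈ T) :
    residue (insert a T) u y k = residue T u y k * ((u k - y a) / (u k - u a)) := by
  have hka : k ≠ a := fun h => ha (h ▸ hk)
  rw [residue, residue, erase_insert_of_ne hka.symm,
    prod_insert (fun h => ha (mem_of_mem_erase h))]
  ring

theorem residue_insert_self {T : Finset ℕ} {u y : ℕ → ℝ} {a : ℕ} (ha : a ∉ T) :
    residue (insert a T) u y a = (u a - y a) * ∏ j ∈ T, (u a - y j) / (u a - u j) := by
  rw [residue, erase_insert ha]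

/-- The partial fraction expansion of `∏ j ∈ T, (v - y j) / (v - u j)`, where the role of
`1 / (v - u j)` is played by any family satisfying the resolvent identity. -/
theorem prod_eq_one_add_sum_residue (T : Finset ℕ) (u y : ℕ → ℝ) (hu : Set.InjOn u T) :
    ∀ (A : Type) [CommRing A] [Algebra ℝ A] (q : ℕ → A),
      (∀ k ∈ T, ∀ j ∈ T, (u k - u j) • (q k * q j) = q k - q j) →
      ∏ j ∈ T, (1 + (u j - y j) • q j) = 1 + ∑ k ∈ T, residue T u y k • q k := by
  induction T using Finset.induction_on with
  | empty => intros; simp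
  | insert a T ha ih =>
    intro A _ _ q hq
    have hT : Set.InjOn u T := hu.mono (by simp)
    have hne : ∀ k ∈ T, u k - u a ≠ 0 := fun k hk h => by
      have := hu (by simp [hk]) (by simp) (sub_eq_zero.1 h)
      exact ha (this ▸ hk)
    -- The induction hypothesis in the algebra `ℝ` with `q k = 1 / (u a - u k)`: evaluating the
    -- expansion at `v = u a` gives the residue at the new pole. This is why the algebra is
    -- quantified inside the induction.
    have hreal : ∏ j ∈ T, (u a - y j) / (u a - u j) =
        1 + ∑ k ∈ T, residue T u y k * (u a - u k)⁻¹ := by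
      have h := ih hT ℝ (fun k => (u a - u k)⁻¹) (fun k hk j hj => by
        have h1 : u a - u k ≠ 0 := fun h => hne k hk (by linarith)
        have h2 : u a - u j ≠ 0 := fun h => hne j hj (by linarith)
        simp only [smul_eq_mul]
        field_simp
        ring)
      refine Eq.trans (prod_congr rfl fun j hj => ?_) h
      have h2 : u a - u j ≠ 0 := fun h => hne j hj (by linarith)
      simp only [smul_eq_mul]
      field_simp
      ring
    have hprod := ih hT A q fun k hk j hj => hq k (by simp [hk]) j (by simp [hj])
    rw [prod_insert ha, hprod, sum_insert ha, residue_insert_self ha, hreal]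
    have hterm : ∀ k ∈ T, residue (insert a T) u y k • q k =
        residue T u y k • q k + (u a - y a) • (residue T u y k • (q a * q k)) -
          ((u a - y a) * (residue T u y k * (u a - u k)⁻¹)) • q a := by
      intro k hk
      have hr := hq k (by simp [hk]) a (by simp)
      have hr' : q a * q k = (u k - u a)⁻¹ • (q k - q a) := by
        rw [← hr, smul_smul, inv_mul_cancel₀ (hne k hk), one_smul, mul_comm]
      have h1 := hne k hk
      have h2 : u a - u k ≠ 0 := fun h => hne k hk (by linarith)
      rw [residue_insert ha hk, hr', ← neg_sub (u k) (u a), inv_neg]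
      have h3 : (u k - y a) / (u k - u a) = 1 + (u a - y a) * (u k - u a)⁻¹ := by
        field_simp
        ring
      rw [h3]
      module
    rw [sum_congr rfl hterm, sum_sub_distrib, sum_add_distrib, ← sum_smul, ← smul_sum, ← mul_sum]
    have h4 : ∑ k ∈ T, residue T u y k • (q a * q k) = q a * ∑ k ∈ T, residue T u y k • q k := by
      rw [mul_sum]
      exact sum_congr rfl fun k _ => (mul_smul_comm _ _ _).symm
    rw [h4]
    generalize ∑ k ∈ T, residue T u y k • q k = s
    rw [add_mul, one_mul, mul_add, mul_one, smul_mul_assoc]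
    module

/-! ### Generating series of the moments of the residues -/

/-- The power series `1 / (1 - x z)`. -/
def geom (x : ℝ) : PowerSeries ℝ := PowerSeries.mk fun n => x ^ n

theorem one_sub_mul_geom (x : ℝ) :
    (1 - PowerSeries.C x * PowerSeries.X) * geom x = 1 := by
  ext n
  rw [sub_mul, one_mul, mul_assoc, map_sub]
  rcases n with _ | n
  · simp [geom]
  · simp [geom, PowerSeries.coeff_succ_X_mul, PowerSeries.coeff_one, pow_succ, mul_comm]

theorem derivative_geom (x : ℝ) :
    PowerSeries.derivative ℝ (geom x) = PowerSeries.C x * geom x * geom x := by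
  have h := one_sub_mul_geom x
  have hd := congrArg (PowerSeries.derivative ℝ) h
  rw [Derivation.leibniz, map_sub, Derivation.leibniz] at hd
  simp only [PowerSeries.derivative_C, Derivation.map_one_eq_zero, PowerSeries.derivative_X,
    smul_eq_mul, mul_zero, mul_one, add_zero, zero_sub] at hd
  linear_combination geom x * hd - (PowerSeries.derivative ℝ (geom x)) * h

/-- The expansion of `∏ j ∈ T, (v - y j) / (v - u j)` in powers of `z = 1 / v`. -/
def ratioSeries (T : Finset ℕ) (u y : ℕ → ℝ) : PowerSeries ℝ :=
  ∏ j ∈ T, (1 - PowerSeries.C (y j) * PowerSeries.X) * geom (u j)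

/-- The logarithmic derivative of `∏ (1 - y z) / (1 - u z)` is the generating series of the
differences of power sums; the product form avoids taking a logarithm. -/
theorem derivative_ratioSeries (T : Finset ℕ) (u y : ℕ → ℝ) :
    PowerSeries.derivative ℝ (ratioSeries T u y) =
      PowerSeries.mk (fun k => ∑ j ∈ T, (u j ^ (k + 1) - y j ^ (k + 1))) * ratioSeries T u y := by
  have hmk : ∀ T : Finset ℕ, PowerSeries.mk (fun k => ∑ j ∈ T, (u j ^ (k + 1) - y j ^ (k + 1))) =
      ∑ j ∈ T, (PowerSeries.C (u j) * geom (u j) - PowerSeries.C (y j) * geom (y j)) := by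
    intro T
    ext k
    simp [geom, pow_succ']
  rw [hmk]
  induction T using Finset.induction_on with
  | empty => simp [ratioSeries]
  | insert a T ha ih =>
    have h : ratioSeries (insert a T) u y =
        (1 - PowerSeries.C (y a) * PowerSeries.X) * geom (u a) * ratioSeries T u y :=
      prod_insert ha
    rw [h, Derivation.leibniz, ih, Derivation.leibniz, map_sub, Derivation.leibniz,
      derivative_geom, sum_insert ha]
    simp only [PowerSeries.derivative_C, Derivation.map_one_eq_zero, PowerSeries.derivative_X,
      smul_eq_mul, mul_zero, mul_one, add_zero, zero_sub]
    linear_combination (PowerSeries.C (y a) * geom (u a) * ratioSeries T u y) *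
      one_sub_mul_geom (y a)

/-- With `z = 1 / v`, the series `z / (1 - u z)` plays the role of `1 / (v - u)`: it satisfies the
resolvent identity, and its coefficient at `z ^ (r + 1)` is `u ^ r`. -/
theorem sum_residue_mul_pow (T : Finset ℕ) (u y : ℕ → ℝ) (hu : Set.InjOn u T) (r : ℕ) :
    ∑ k ∈ T, residue T u y k * u k ^ r = PowerSeries.coeff (r + 1) (ratioSeries T u y) := by
  have h := prod_eq_one_add_sum_residue T u y hu (PowerSeries ℝ)
    (fun k => PowerSeries.X * geom (u k)) (fun k _ j _ => by
      rw [PowerSeries.smul_eq_C_mul, map_sub]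
      linear_combination PowerSeries.X * (geom (u k)) * one_sub_mul_geom (u j) -
        PowerSeries.X * (geom (u j)) * one_sub_mul_geom (u k))
  have h2 : ratioSeries T u y =
      ∏ j ∈ T, (1 + (u j - y j) • (PowerSeries.X * geom (u j))) := by
    refine prod_congr rfl fun j _ => ?_
    rw [PowerSeries.smul_eq_C_mul, map_sub]
    linear_combination one_sub_mul_geom (u j)
  rw [h2, h, map_add, map_sum]
  simp [PowerSeries.coeff_one, PowerSeries.coeff_succ_X_mul, geom]

/-- The coefficients of `exp (∑ g_k z ^ (k + 1) / (k + 1))`. -/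
def expCoeff (g : ℕ → Gam) : ℕ → Gam
  | 0 => 1
  | r + 1 => ((r : ℝ) + 1)⁻¹ • ∑ k : Fin (r + 1), g k * expCoeff g (r - k)

theorem expCoeff_zero (g : ℕ → Gam) : expCoeff g 0 = 1 := by
  rw [expCoeff]

theorem expCoeff_succ (g : ℕ → Gam) (r : ℕ) :
    expCoeff g (r + 1) =
      ((r : ℝ) + 1)⁻¹ • ∑ k ∈ range (r + 1), g k * expCoeff g (r - k) := by
  rw [expCoeff, Finset.sum_range]

/-- The recurrence defining `expCoeff` is `F' = G F` read coefficientwise, the equation satisfied by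
`ratioSeries`, and both solutions start at `1`. -/
theorem map_expCoeff {g : ℕ → Gam} (φ : Gam →ₐ[ℝ] ℝ) (T : Finset ℕ) (u y : ℕ → ℝ)
    (hg : ∀ k, φ (g k) = ∑ j ∈ T, (u j ^ (k + 1) - y j ^ (k + 1))) (r : ℕ) :
    φ (expCoeff g r) = PowerSeries.coeff r (ratioSeries T u y) := by
  induction r using Nat.strong_induction_on with
  | _ r ih =>
    rcases r with _ | r
    · rw [expCoeff_zero, map_one, PowerSeries.coeff_zero_eq_constantCoeff_apply, ratioSeries,
        map_prod]
      simp [geom]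
    · have h := congrArg (PowerSeries.coeff r) (derivative_ratioSeries T u y)
      rw [PowerSeries.coeff_derivative, PowerSeries.coeff_mul,
        Finset.Nat.sum_antidiagonal_eq_sum_range_succ_mk] at h
      rw [expCoeff_succ, map_smul, map_sum, smul_eq_mul, inv_mul_eq_iff_eq_mul₀ (by positivity),
        mul_comm, h]
      refine sum_congr rfl fun k hk => ?_
      rw [map_mul, hg, ih _ (by omega), PowerSeries.coeff_mk]

/-! ### Evaluation at a finite set of parts -/

/-- The value of an element of `Γ` at the strict partition with set of parts `S`. -/
def ev (S : Finset ℕ) : Gam →ₐ[ℝ] ℝ :=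
  MvPolynomial.aeval fun i => ∑ k ∈ S, (k : ℝ) ^ (2 * i + 1)

theorem ev_p (S : Finset ℕ) (i : ℕ) : ev S (p i) = ∑ k ∈ S, (k : ℝ) ^ (2 * i + 1) := by
  simp [ev, p]

/-- The eigenvalue `k (k + 1)` of the box that can be added to a row of length `k`. -/
def upNode (k : ℕ) : ℝ := k * (k + 1)

/-- The eigenvalue `k (k - 1)` of the box that can be removed from a row of length `k`. -/
def downNode (k : ℕ) : ℝ := k * (k - 1)

theorem upNode_injective : Function.Injective upNode := by
  intro a b h
  have h2 : ((a : ℝ) - b) * (a + b + 1) = 0 := by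
    simp only [upNode] at h
    linear_combination h
  rcases mul_eq_zero.1 h2 with h3 | h3
  · exact_mod_cast sub_eq_zero.1 h3
  · have : (0 : ℝ) ≤ (a : ℝ) + b := by positivity
    linarith

theorem downNode_succ (k : ℕ) : downNode (k + 1) = upNode k := by
  simp only [downNode, upNode]
  push_cast
  ring

theorem downNode_injOn {S : Finset ℕ} (h0 : 0 ∉ S) : Set.InjOn downNode S := by
  intro a ha b hb h
  obtain ⟨a, rfl⟩ := Nat.exists_eq_succ_of_ne_zero (fun h : a = 0 => h0 (h ▸ ha))
  obtain ⟨b, rfl⟩ := Nat.exists_eq_succ_of_ne_zero (fun h : b = 0 => h0 (h ▸ hb))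
  rw [Nat.succ_eq_add_one, Nat.succ_eq_add_one, downNode_succ, downNode_succ] at h
  rw [upNode_injective h]

/-- The set of parts after adding a box to a row of length `m`. -/
def raise (S : Finset ℕ) (m : ℕ) : Finset ℕ := insert (m + 1) (S.erase m)

/-- The set of parts after removing a box from a row of length `k`. -/
def lower (S : Finset ℕ) (k : ℕ) : Finset ℕ := (insert (k - 1) (S.erase k)).erase 0

/-- An empty row counts as a phantom part `0`. The condition `f 0 = 0` makes it invisible, so
opening a new row needs no separate formula. -/
theorem sum_raise {S : Finset ℕ} {m : ℕ} (hm : m ∈ insert 0 S) (hm1 : m + 1 ∉ S) {f : ℕ → ℝ}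
    (hf : f 0 = 0) : ∑ k ∈ raise S m, f k = ∑ k ∈ S, f k + (f (m + 1) - f m) := by
  rw [raise, sum_insert fun h => hm1 (mem_of_mem_erase h)]
  by_cases hS : m ∈ S
  · rw [← add_sum_erase S f hS]
    ring
  · have h0 : m = 0 := by simpa [hS] using hm
    rw [erase_eq_of_notMem hS, h0, hf]
    ring

theorem sum_lower {S : Finset ℕ} {k : ℕ} (hk : k ∈ S) (hk1 : k - 1 ∉ S) {f : ℕ → ℝ}
    (hf : f 0 = 0) : ∑ j ∈ lower S k, f j = ∑ j ∈ S, f j + (f (k - 1) - f k) := by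
  rw [lower, sum_erase _ hf, sum_insert fun h => hk1 (mem_of_mem_erase h),
    ← add_sum_erase S f hk]
  ring

/-! ### Polynomials attached to adding a box -/

/-- The polynomial in `x (x + 1)` equal to `(x + 1) ^ (2 i + 1) - x ^ (2 i + 1)`. -/
def shiftPoly : ℕ → Polynomial ℝ
  | 0 => 1
  | 1 => 3 * Polynomial.X + 1
  | i + 2 => (2 * Polynomial.X + 1) * shiftPoly (i + 1) - Polynomial.X ^ 2 * shiftPoly i

/-- With `t = x (x + 1)`, the numbers `(x + 1) ^ 2` and `x ^ 2` have sum `2 t + 1` and product `t ^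
2`, so both sequences of powers obey the recurrence of `shiftPoly`. -/
theorem eval_shiftPoly (x : ℝ) (i : ℕ) :
    (shiftPoly i).eval (x * (x + 1)) = (x + 1) ^ (2 * i + 1) - x ^ (2 * i + 1) := by
  induction i using Nat.twoStepInduction with
  | zero => simp [shiftPoly]
  | one => simp [shiftPoly]; ring
  | more i h0 h1 =>
    simp only [shiftPoly, Polynomial.eval_sub, Polynomial.eval_mul, Polynomial.eval_add,
      Polynomial.eval_pow, Polynomial.eval_X, Polynomial.eval_one, Polynomial.eval_ofNat, h0, h1]
    ring

theorem eval_upNode_shiftPoly (m i : ℕ) :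
    (shiftPoly i).eval (upNode m) = ((m + 1 : ℕ) : ℝ) ^ (2 * i + 1) - (m : ℝ) ^ (2 * i + 1) := by
  rw [upNode, eval_shiftPoly]
  push_cast
  rfl

/-- The polynomial in `x ^ 2` equal to `((x (x + 1)) ^ n - (x (x - 1)) ^ n) / x`. -/
def nodePoly : ℕ → Polynomial ℝ
  | 0 => 0
  | 1 => 2
  | n + 2 => 2 * Polynomial.X * nodePoly (n + 1) - (Polynomial.X ^ 2 - Polynomial.X) * nodePoly n

/-- The numbers `x (x + 1)` and `x (x - 1)` have sum `2 x ^ 2` and product `x ^ 4 - x ^ 2`, which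
are the coefficients of the recurrence of `nodePoly`. -/
theorem eval_nodePoly (x : ℝ) (n : ℕ) :
    x * (nodePoly n).eval (x ^ 2) = (x * (x + 1)) ^ n - (x * (x - 1)) ^ n := by
  induction n using Nat.twoStepInduction with
  | zero => simp [nodePoly]
  | one => simp [nodePoly]; ring
  | more n h0 h1 =>
    simp only [nodePoly, Polynomial.eval_sub, Polynomial.eval_mul,
      Polynomial.eval_pow, Polynomial.eval_X, Polynomial.eval_ofNat]
    linear_combination 2 * x ^ 2 * h1 - (x ^ 4 - x ^ 2) * h0

/-- The linear map sending `y ^ i` to `p_{2i+1}`. -/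
def powerSum : Polynomial ℝ →ₗ[ℝ] Gam :=
  Polynomial.lsum fun i => LinearMap.toSpanSingleton ℝ Gam (p i)

theorem powerSum_monomial (i : ℕ) (c : ℝ) : powerSum (Polynomial.monomial i c) = c • p i := by
  simp [powerSum, Polynomial.lsum, Polynomial.sum_monomial_index]

theorem ev_powerSum (S : Finset ℕ) (P : Polynomial ℝ) :
    ev S (powerSum P) = ∑ k ∈ S, (k : ℝ) * P.eval ((k : ℝ) ^ 2) := by
  induction P using Polynomial.induction_on' with
  | add P Q hP hQ => simp only [map_add, hP, hQ, Polynomial.eval_add, mul_add, sum_add_distrib]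
  | monomial i c =>
    rw [powerSum_monomial, map_smul, ev_p, smul_eq_mul, mul_sum]
    refine sum_congr rfl fun k _ => ?_
    rw [Polynomial.eval_monomial]
    ring

/-- The sum of `(k (k + 1)) ^ (r + 1) - (k (k - 1)) ^ (r + 1)` over the parts `k`. -/
def nodeSum (r : ℕ) : Gam := powerSum (nodePoly (r + 1))

theorem ev_nodeSum (S : Finset ℕ) (r : ℕ) :
    ev S (nodeSum r) = ∑ k ∈ S, (upNode k ^ (r + 1) - downNode k ^ (r + 1)) := by
  rw [nodeSum, ev_powerSum]
  exact sum_congr rfl fun k _ => eval_nodePoly _ _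

/-! ### Moments of the down and up transition weights -/

/-- The down weights, which are `n` times the down transition probabilities. -/
def downWeight (S : Finset ℕ) (k : ℕ) : ℝ := (-1 / 2) * residue S downNode upNode k

/-- The moments of the down weights. -/
def downMoment (r : ℕ) : Gam := (-1 / 2 : ℝ) • expCoeff (fun k => -nodeSum k) (r + 1)

/-- Here the poles are the down nodes and the zeros the up nodes; exchanging them negates the
logarithm, hence `-nodeSum` in the exponent. -/
theorem ev_downMoment {S : Finset ℕ} (h0 : 0 ∉ S) (r : ℕ) :
    ev S (downMoment r) = ∑ k ∈ S, downWeight S k * downNode k ^ r := by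
  rw [downMoment, map_smul, map_expCoeff (ev S) S downNode upNode, ← sum_residue_mul_pow,
    smul_eq_mul, mul_sum]
  · exact sum_congr rfl fun k _ => by rw [downWeight, mul_assoc]
  · exact downNode_injOn h0
  · intro k
    rw [map_neg, ev_nodeSum, ← sum_neg_distrib]
    exact sum_congr rfl fun k _ => by ring

/-- The zeros that govern the up transition weights. -/
def upZero (α : ℝ) (j : ℕ) : ℝ := if j = 0 then -α else downNode j

/-- The up weights, which are `2 n + α` times the up transition probabilities. -/
def upWeight (α : ℝ) (S : Finset ℕ) (m : ℕ) : ℝ := residue (insert 0 S) upNode (upZero α) m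

/-- The moments of the up weights. -/
def upMoment (α : ℝ) (r : ℕ) : Gam := expCoeff nodeSum (r + 1) + α • expCoeff nodeSum r

/-- The phantom row contributes the factor `(v + α) / v = 1 + α z`, which produces the two terms of
`upMoment`. -/
theorem ev_upMoment (α : ℝ) {S : Finset ℕ} (h0 : 0 ∉ S) (r : ℕ) :
    ev S (upMoment α r) = ∑ m ∈ insert 0 S, upWeight α S m * upNode m ^ r := by
  have hS : ratioSeries (insert 0 S) upNode (upZero α) =
      (1 + PowerSeries.C α * PowerSeries.X) * ratioSeries S upNode downNode := by
    rw [ratioSeries, prod_insert h0, ratioSeries]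
    have h1 : (1 - PowerSeries.C (upZero α 0) * PowerSeries.X) * geom (upNode 0) =
        1 + PowerSeries.C α * PowerSeries.X := by
      have h2 := one_sub_mul_geom (upNode 0)
      have h3 : upNode 0 = 0 := by simp [upNode]
      rw [h3, map_zero, zero_mul, sub_zero, one_mul] at h2
      rw [h3, h2, upZero, if_pos rfl, map_neg]
      ring
    rw [h1]
    congr 1
    refine prod_congr rfl fun j hj => ?_
    rw [upZero, if_neg (by rintro rfl; exact h0 hj)]
  simp only [upWeight]
  rw [sum_residue_mul_pow _ _ _ upNode_injective.injOn, hS, upMoment, map_add, map_smul,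
    map_expCoeff (ev S) S upNode downNode (ev_nodeSum S),
    map_expCoeff (ev S) S upNode downNode (ev_nodeSum S), add_mul, one_mul, map_add, mul_assoc,
    PowerSeries.coeff_C_mul, PowerSeries.coeff_succ_X_mul, smul_eq_mul]

/-! ### The down and up operators on `Γ` -/

/-- The `Γ`-linear map sending `t ^ k` to `a k`. -/
def momentMap (a : ℕ → Gam) : Polynomial Gam →ₗ[Gam] Gam :=
  Polynomial.lsum fun k => LinearMap.toSpanSingleton Gam Gam (a k)

theorem momentMap_monomial (a : ℕ → Gam) (k : ℕ) (c : Gam) :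
    momentMap a (Polynomial.monomial k c) = c * a k := by
  simp [momentMap, Polynomial.lsum, Polynomial.sum_monomial_index]

theorem ev_momentMap {S T : Finset ℕ} {a : ℕ → Gam} {w v : ℕ → ℝ}
    (h : ∀ r, ev S (a r) = ∑ k ∈ T, w k * v k ^ r) (P : Polynomial Gam) :
    ev S (momentMap a P) = ∑ k ∈ T, w k * P.eval₂ (ev S : Gam →+* ℝ) (v k) := by
  induction P using Polynomial.induction_on' with
  | add P Q hP hQ => simp only [map_add, hP, hQ, Polynomial.eval₂_add, mul_add, sum_add_distrib]
  | monomial i c =>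
    rw [momentMap_monomial, map_mul, h, mul_sum]
    refine sum_congr rfl fun k _ => ?_
    rw [Polynomial.eval₂_monomial, AlgHom.coe_toRingHom]
    ring

/-- The translation of the generators of `Γ` by `s` times the effect of adding a box with
eigenvalue `t`. -/
def taylor (s : ℝ) : Gam →ₐ[ℝ] Polynomial Gam :=
  MvPolynomial.aeval fun i =>
    Polynomial.C (p i) + (s • shiftPoly i).map (algebraMap ℝ Gam)

theorem eval₂_taylor (S : Finset ℕ) (s x : ℝ) {S' : Finset ℕ}
    (h : ∀ i, ∑ k ∈ S', (k : ℝ) ^ (2 * i + 1) =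
      ∑ k ∈ S, (k : ℝ) ^ (2 * i + 1) + s * (shiftPoly i).eval x) (f : Gam) :
    (taylor s f).eval₂ (ev S : Gam →+* ℝ) x = ev S' f := by
  have hcomp : (ev S : Gam →+* ℝ).comp (algebraMap ℝ Gam) = RingHom.id ℝ := by
    ext r
    simp
  induction f using MvPolynomial.induction_on with
  | C c =>
    rw [← MvPolynomial.algebraMap_eq, AlgHom.commutes, AlgHom.commutes,
      Polynomial.algebraMap_apply, Polynomial.eval₂_C]
    exact RingHom.congr_fun hcomp c
  | add f g hf hg => rw [map_add, Polynomial.eval₂_add, hf, hg, map_add]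
  | mul_X f i hf =>
    rw [map_mul, Polynomial.eval₂_mul, hf, map_mul]
    congr 1
    rw [show ev S' (MvPolynomial.X i) = _ from ev_p S' i, h]
    rw [taylor, MvPolynomial.aeval_X, Polynomial.eval₂_add, Polynomial.eval₂_C,
      Polynomial.eval₂_map, hcomp, Polynomial.eval₂_id, Polynomial.eval_smul, smul_eq_mul,
      AlgHom.coe_toRingHom, ev_p]

/-- The operator on `Γ` representing `n` times the down transition operator. -/
def downOp : Gam →ₗ[ℝ] Gam :=
  (momentMap downMoment).restrictScalars ℝ ∘ₗ (taylor (-1)).toLinearMap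

/-- The operator on `Γ` representing `2 n + α` times the up transition operator. -/
def upOp (α : ℝ) : Gam →ₗ[ℝ] Gam :=
  (momentMap (upMoment α)).restrictScalars ℝ ∘ₗ (taylor 1).toLinearMap

/-- If `k - 1` is also a part, the zero at `upNode (k - 1) = downNode k` cancels the pole. Sums over
all parts therefore need no restriction to removable boxes. -/
theorem downWeight_eq_zero {S : Finset ℕ} (h0 : 0 ∉ S) {k : ℕ} (hk : k ∈ S) (hk1 : k - 1 ∈ S) :
    downWeight S k = 0 := by
  obtain ⟨k, rfl⟩ := Nat.exists_eq_succ_of_ne_zero (fun h : k = 0 => h0 (h ▸ hk))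
  rw [Nat.succ_eq_add_one, Nat.add_sub_cancel] at hk1
  rw [downWeight, residue, prod_eq_zero (i := k) (by simp [hk1]) (by simp [downNode_succ])]
  ring

theorem upWeight_eq_zero (α : ℝ) {S : Finset ℕ} {m : ℕ} (hm1 : m + 1 ∈ S) :
    upWeight α S m = 0 := by
  rw [upWeight, residue, prod_eq_zero (i := m + 1) (by simp [hm1])
    (by simp [upZero, downNode_succ]), mul_zero]

theorem ev_downOp {S : Finset ℕ} (h0 : 0 ∉ S) (f : Gam) :
    ev S (downOp f) = ∑ k ∈ S, downWeight S k * ev (lower S k) f := by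
  change ev S (momentMap downMoment (taylor (-1) f)) = _
  rw [ev_momentMap (ev_downMoment h0)]
  refine sum_congr rfl fun k hk => ?_
  by_cases hk1 : k - 1 ∈ S
  · rw [downWeight_eq_zero h0 hk hk1, zero_mul, zero_mul]
  · rw [eval₂_taylor S (-1) (downNode k) (S' := lower S k)]
    intro i
    rw [sum_lower (f := fun k : ℕ => (k : ℝ) ^ (2 * i + 1)) hk hk1 (by simp)]
    obtain ⟨k, rfl⟩ := Nat.exists_eq_succ_of_ne_zero (fun h : k = 0 => h0 (h ▸ hk))
    rw [Nat.succ_eq_add_one, Nat.add_sub_cancel, downNode_succ, eval_upNode_shiftPoly]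
    ring

theorem ev_upOp (α : ℝ) {S : Finset ℕ} (h0 : 0 ∉ S) (f : Gam) :
    ev S (upOp α f) = ∑ m ∈ insert 0 S, upWeight α S m * ev (raise S m) f := by
  change ev S (momentMap (upMoment α) (taylor 1 f)) = _
  rw [ev_momentMap (ev_upMoment α h0)]
  refine sum_congr rfl fun m hm => ?_
  by_cases hm1 : m + 1 ∈ S
  · rw [upWeight_eq_zero α hm1, zero_mul, zero_mul]
  · rw [eval₂_taylor S 1 (upNode m) (S' := raise S m)]
    intro i
    rw [sum_raise (f := fun k : ℕ => (k : ℝ) ^ (2 * i + 1)) hm hm1 (by simp),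
      eval_upNode_shiftPoly]
    ring

/-- The zeroth moment. It drives the induction in the hook formula, where it supplies the factor `n
+ 1` of the factorial. -/
theorem sum_downWeight {S : Finset ℕ} (h0 : 0 ∉ S) : ∑ k ∈ S, downWeight S k = ∑ k ∈ S, (k : ℝ) := by
  have h := ev_downMoment h0 0
  have h1 : expCoeff (fun k => -nodeSum k) 1 = -nodeSum 0 := by
    rw [show (1 : ℕ) = 0 + 1 from rfl, expCoeff_succ]
    simp [expCoeff_zero]
  simp only [pow_zero, mul_one] at h
  rw [← h, downMoment, zero_add, h1, map_smul, map_neg, ev_nodeSum, smul_eq_mul, ← sum_neg_distrib,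
    mul_sum]
  refine sum_congr rfl fun k _ => ?_
  simp only [upNode, downNode]
  ring

/-! ### Strict partitions as finite sets of parts -/

/-- The set of parts of a strict partition. -/
def partSet {n : ℕ} (lam : Strict n) : Finset ℕ := lam.1.parts.toFinset

theorem partSet_val {n : ℕ} (lam : Strict n) : (partSet lam).val = lam.1.parts := by
  have h := lam.2
  simp only [Nat.Partition.distincts, mem_filter, mem_univ, true_and] at h
  rw [partSet, Multiset.toFinset_val, h.dedup]

theorem zero_notMem_partSet {n : ℕ} (lam : Strict n) : 0 ∉ partSet lam := fun h => by
  rw [partSet, Multiset.mem_toFinset] at h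
  exact lt_irrefl 0 (lam.1.parts_pos h)

theorem sum_partSet {n : ℕ} (lam : Strict n) : ∑ k ∈ partSet lam, k = n := by
  rw [Finset.sum, partSet_val, Multiset.map_id', lam.1.parts_sum]

theorem sum_partSet_cast {n : ℕ} (lam : Strict n) : ∑ k ∈ partSet lam, (k : ℝ) = n := by
  rw [← Nat.cast_sum, sum_partSet]

theorem partSet_injective {n : ℕ} : Function.Injective (partSet (n := n)) := by
  intro a b h
  apply Subtype.ext
  apply Nat.Partition.ext
  rw [← partSet_val, ← partSet_val, h]

theorem exists_partSet_eq {n : ℕ} {S : Finset ℕ} (h0 : 0 ∉ S) (hS : ∑ k ∈ S, k = n) :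
    ∃ lam : Strict n, partSet lam = S := by
  refine ⟨⟨⟨S.val, fun {i} hi => Nat.pos_of_ne_zero fun h => h0 (h ▸ hi), ?_⟩, ?_⟩, ?_⟩
  · rw [← hS, Finset.sum, Multiset.map_id']
  · simp [Nat.Partition.distincts, S.nodup]
  · simp [partSet]

theorem len_eq_card {n : ℕ} (lam : Strict n) : len lam = (partSet lam).card := by
  rw [len, ← partSet_val, card_val]

theorem restrict_apply {n : ℕ} (f : Gam) (lam : Strict n) : restrict n f lam = ev (partSet lam) f := by
  have h : (Pi.evalAlgHom ℝ (fun _ : Strict n => ℝ) lam).comp (restrict n) = ev (partSet lam) := by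
    ext i
    simp [restrict, ev, Finset.sum, partSet_val]
  exact DFunLike.congr_fun h f

theorem rowOf_eq {n : ℕ} (lam : Strict n) (m : ℕ) :
    rowOf lam m = ((partSet lam).filter (m ≤ ·)).card := by
  rw [rowOf, Finset.card_def, Finset.filter_val, partSet_val]

theorem rowOf_injOn {n : ℕ} (lam : Strict n) : Set.InjOn (rowOf lam) (partSet lam) := by
  have key : ∀ a ∈ partSet lam, ∀ b, a < b → rowOf lam b < rowOf lam a := by
    intro a ha b hab
    rw [rowOf_eq, rowOf_eq]
    refine card_lt_card ⟨fun x hx => ?_, fun h => ?_⟩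
    · simp only [mem_filter] at hx ⊢
      exact ⟨hx.1, by omega⟩
    · have := h (by simp [ha] : a ∈ _)
      simp only [mem_filter] at this
      omega
  intro a ha b hb h
  rcases lt_trichotomy a b with hab | hab | hab
  · have := key a ha b hab
    omega
  · exact hab
  · have := key b hb a hab
    omega

/-! ### Adding a box, in terms of the set of parts -/

theorem mem_diagram {n : ℕ} (lam : Strict n) (b : ℕ × ℕ) :
    b ∈ diagram lam ↔ ∃ k ∈ partSet lam, ∃ c < k, (rowOf lam k, rowOf lam k + c) = b := by
  simp [diagram, partSet]

/-- Every row meets a given diagonal at most once, and row numbers are distinct. Counting along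
diagonals recovers the parts from the diagram without tracking which row is which. -/
theorem card_content {n : ℕ} (lam : Strict n) (c : ℕ) :
    ((diagram lam).filter fun b => b.2 = b.1 + c).card =
      ((partSet lam).filter (c < ·)).card := by
  have h : (diagram lam).filter (fun b => b.2 = b.1 + c) =
      ((partSet lam).filter (c < ·)).image fun k => (rowOf lam k, rowOf lam k + c) := by
    ext b
    simp only [mem_filter, mem_diagram, mem_image]
    constructor
    · rintro ⟨⟨k, hk, d, hd, rfl⟩, h⟩
      have h' : d = c := by simpa using h
      exact ⟨k, ⟨hk, h' ▸ hd⟩, by rw [h']⟩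
    · rintro ⟨k, ⟨hk, hc⟩, rfl⟩
      exact ⟨⟨k, hk, c, hc, rfl⟩, rfl⟩
  rw [h, card_image_of_injOn]
  intro a ha b hb hab
  exact rowOf_injOn lam (mem_filter.1 ha).1 (mem_filter.1 hb).1 (Prod.ext_iff.1 hab).1

theorem card_filter_lt (S : Finset ℕ) (c : ℕ) :
    (S.filter (c < ·)).card = (if c + 1 ∈ S then 1 else 0) + (S.filter (c + 1 < ·)).card := by
  split_ifs with h
  · rw [show S.filter (c < ·) = insert (c + 1) (S.filter (c + 1 < ·)) by
      ext x
      simp only [mem_filter, mem_insert]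
      constructor
      · rintro ⟨h1, h2⟩
        by_cases hx : x = c + 1
        · exact Or.inl hx
        · exact Or.inr ⟨h1, by omega⟩
      · rintro (rfl | ⟨h1, h2⟩)
        · exact ⟨h, by omega⟩
        · exact ⟨h1, by omega⟩,
      card_insert_of_notMem (by simp), add_comm]
  · rw [zero_add]
    congr 1
    refine filter_congr fun x hx => ?_
    have : x ≠ c + 1 := fun h' => h (h' ▸ hx)
    omega

/-- A new box on the diagonal `m` changes only the number of parts exceeding `m`. Differences of
consecutive counts are membership indicators, so `m + 1` appears and `m` disappears when it is
nonzero. -/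
theorem exists_raise_of_addsBox {n k : ℕ} {lam : Strict n} {nu : Strict k} (h : AddsBox lam nu) :
    ∃ m ∈ insert 0 (partSet lam), m + 1 ∉ partSet lam ∧ partSet nu = raise (partSet lam) m := by
  obtain ⟨b, hb, hb', hins⟩ := h
  obtain ⟨k₀, -, m, -, rfl⟩ := (mem_diagram nu b).1 hb
  have hcount : ∀ c, ((partSet nu).filter (c < ·)).card =
      ((partSet lam).filter (c < ·)).card + if m = c then 1 else 0 := by
    intro c
    rw [← card_content, ← card_content, ← hins, filter_insert]
    by_cases hc : m = c
    · rw [if_pos (by rw [hc]), if_pos hc, card_insert_of_notMem fun h => hb' (mem_filter.1 h).1]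
    · rw [if_neg (by simpa using hc), if_neg hc, add_zero]
  have hind : ∀ c, ((if c + 1 ∈ partSet nu then 1 else 0) + if m = c + 1 then 1 else 0) =
      (if c + 1 ∈ partSet lam then 1 else 0) + if m = c then 1 else 0 := by
    intro c
    have h1 := hcount c
    have h2 := hcount (c + 1)
    rw [card_filter_lt, card_filter_lt (partSet lam)] at h1
    omega
  have hnu0 := zero_notMem_partSet nu
  have hlam0 := zero_notMem_partSet lam
  refine ⟨m, ?_, ?_, ?_⟩
  · rcases m with _ | m
    · simp
    · have := hind m
      by_contra hm
      simp only [mem_insert, Nat.add_eq_zero_iff, one_ne_zero, and_false, false_or] at hm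
      simp [hm] at this
  · intro hm
    have := hind m
    simp only [hm, if_true, if_neg (show ¬ m = m + 1 by omega)] at this
    split_ifs at this
    all_goals omega
  · ext x
    rcases x with _ | x
    · simp [raise, hnu0, hlam0]
    · have := hind x
      simp only [raise, mem_insert, mem_erase, Nat.add_right_cancel_iff]
      by_cases h1 : m = x
      · subst h1
        simp only [if_neg (show ¬ m = m + 1 by omega), if_true] at this
        split_ifs at this
        all_goals first | omega | simp_all
      · by_cases h2 : m = x + 1
        · subst h2
          simp only [h1, if_true, if_false] at this
          split_ifs at this
          all_goals first | omega | simp_all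
        · simp only [h1, h2, if_false, add_zero] at this
          split_ifs at this
          all_goals first | omega | (simp_all; omega)

theorem card_filter_le_raise {S : Finset ℕ} {m : ℕ} (hm : m ∈ insert 0 S)
    (hm1 : m + 1 ∉ S) {k : ℕ} (hk : k ≠ 0) :
    ((raise S m).filter (k ≤ ·)).card =
      (S.filter (k ≤ ·)).card + if k = m + 1 then 1 else 0 := by
  have h := sum_raise hm hm1 (f := fun j : ℕ => if k ≤ j then (1 : ℝ) else 0) (by simp [hk])
  rw [sum_boole, sum_boole] at h
  have h2 : ((if k ≤ m + 1 then (1 : ℝ) else 0) - if k ≤ m then (1 : ℝ) else 0) =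
      ((if k = m + 1 then 1 else 0 : ℕ) : ℝ) := by
    split_ifs
    all_goals first | omega | simp
  rw [h2] at h
  exact_mod_cast h

/-- Raising a part to a value not yet taken preserves the order of the parts, so every row keeps its
number and only one box is new. -/
theorem diagram_of_raise {n k : ℕ} {lam : Strict n} {nu : Strict k} {m : ℕ}
    (hm : m ∈ insert 0 (partSet lam)) (hm1 : m + 1 ∉ partSet lam)
    (h : partSet nu = raise (partSet lam) m) :
    ∃ r, (r, r + m) ∉ diagram lam ∧ insert (r, r + m) (diagram lam) = diagram nu := by
  have h0 := zero_notMem_partSet lam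
  have hrow : ∀ k ∈ partSet lam, k ≠ m → rowOf nu k = rowOf lam k := by
    intro k hk hkm
    have hk0 : k ≠ 0 := fun h => h0 (h ▸ hk)
    have hk1 : k ≠ m + 1 := fun h => hm1 (h ▸ hk)
    rw [rowOf_eq, rowOf_eq, h, card_filter_le_raise hm hm1 hk0, if_neg hk1, add_zero]
  have hself : m ∈ partSet lam → rowOf nu (m + 1) = rowOf lam m := by
    intro hmS
    have hm0 : m ≠ 0 := fun h => h0 (h ▸ hmS)
    obtain ⟨m, rfl⟩ := Nat.exists_eq_succ_of_ne_zero hm0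
    have := card_filter_lt (partSet lam) m
    rw [if_pos hmS] at this
    rw [rowOf_eq, rowOf_eq, h, card_filter_le_raise hm hm1 (by omega), if_pos rfl, add_comm]
    exact this.symm
  have hmem : m + 1 ∈ partSet nu := by simp [h, raise]
  refine ⟨rowOf nu (m + 1), fun hb => ?_, ?_⟩
  · obtain ⟨k, hk, c, hc, hkc⟩ := (mem_diagram _ _).1 hb
    obtain ⟨h1, h2⟩ := Prod.ext_iff.1 hkc
    simp only at h1 h2
    have hkm : k ≠ m := by omega
    rw [← hrow k hk hkm] at h1
    have := rowOf_injOn nu (show k ∈ partSet nu by simp [h, raise, hk, hkm]) hmem h1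
    exact hm1 (this ▸ hk)
  · ext b
    simp only [mem_insert, mem_diagram]
    constructor
    · rintro (rfl | ⟨k, hk, c, hc, rfl⟩)
      · exact ⟨m + 1, hmem, m, by omega, rfl⟩
      · by_cases hkm : k = m
        · subst hkm
          exact ⟨k + 1, hmem, c, by omega, by rw [hself hk]⟩
        · exact ⟨k, by simp [h, raise, hk, hkm], c, hc, by rw [hrow k hk hkm]⟩
    · rintro ⟨k, hk, c, hc, rfl⟩
      rw [h, raise, mem_insert, mem_erase] at hk
      rcases hk with rfl | ⟨hkm, hk⟩
      · by_cases hcm : c = m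
        · exact Or.inl (by rw [hcm])
        · have hm0 : m ≠ 0 := by omega
          have hmS : m ∈ partSet lam := by simpa [hm0] using hm
          exact Or.inr ⟨m, hmS, c, by omega, by rw [hself hmS]⟩
      · exact Or.inr ⟨k, hk, c, hc, by rw [hrow k hk hkm]⟩

theorem addsBox_of_raise {n k : ℕ} {lam : Strict n} {nu : Strict k} {m : ℕ}
    (hm : m ∈ insert 0 (partSet lam)) (hm1 : m + 1 ∉ partSet lam)
    (h : partSet nu = raise (partSet lam) m) : AddsBox lam nu := by
  obtain ⟨r, h1, h2⟩ := diagram_of_raise hm hm1 h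
  exact ⟨_, h2 ▸ mem_insert_self _ _, h1, h2⟩

/-- The multiplicity of the edge that adds a box to a row of length `m`. -/
def edgeMult (m : ℕ) : ℕ := if m = 0 then 1 else 2

theorem card_raise {S : Finset ℕ} (h0 : 0 ∉ S) {m : ℕ} (hm : m ∈ insert 0 S) (hm1 : m + 1 ∉ S) :
    (raise S m).card = S.card + if m = 0 then 1 else 0 := by
  rw [raise, card_insert_of_notMem fun h => hm1 (mem_of_mem_erase h)]
  split_ifs with h
  · rw [h, erase_eq_of_notMem h0]
  · exact card_erase_add_one (by simpa [h] using hm)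

theorem kappa_of_raise {n : ℕ} {lam : Strict n} {nu : Strict (n + 1)} {m : ℕ}
    (hm : m ∈ insert 0 (partSet lam)) (hm1 : m + 1 ∉ partSet lam)
    (h : partSet nu = raise (partSet lam) m) : kappa lam nu = edgeMult m := by
  have hb := addsBox_of_raise hm hm1 h
  have hl : len nu = len lam + if m = 0 then 1 else 0 := by
    rw [len_eq_card, len_eq_card, h, card_raise (zero_notMem_partSet lam) hm hm1]
  rw [kappa, edgeMult]
  split_ifs at * <;> simp_all

theorem kappa_eq_zero {n : ℕ} {lam : Strict n} {nu : Strict (n + 1)} (h : ¬ AddsBox lam nu) :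
    kappa lam nu = 0 := by
  simp [kappa, h]

theorem zero_notMem_raise {S : Finset ℕ} (h0 : 0 ∉ S) (m : ℕ) : 0 ∉ raise S m := by
  simp [raise, h0]

theorem zero_notMem_lower (S : Finset ℕ) (k : ℕ) : 0 ∉ lower S k := by
  simp [lower]

theorem lower_raise {S : Finset ℕ} (h0 : 0 ∉ S) {m : ℕ} (hm : m ∈ insert 0 S) (hm1 : m + 1 ∉ S) :
    lower (raise S m) (m + 1) = S := by
  rw [lower, raise, erase_insert fun h => hm1 (mem_of_mem_erase h), Nat.add_sub_cancel]
  by_cases h : m = 0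
  · rw [h, erase_insert_eq_erase, erase_eq_of_notMem (by simp), erase_eq_of_notMem h0]
  · rw [insert_erase (by simpa [h] using hm), erase_eq_of_notMem h0]

theorem raise_lower {S : Finset ℕ} (h0 : 0 ∉ S) {m : ℕ} (hm1 : m + 1 ∈ S) (hm : m ∉ S) :
    m ∈ insert 0 (lower S (m + 1)) ∧ m + 1 ∉ lower S (m + 1) ∧
      raise (lower S (m + 1)) m = S := by
  refine ⟨?_, ?_, ?_⟩
  · simp only [lower, mem_insert, mem_erase, Nat.add_sub_cancel]
    tauto
  · simp [lower]
  · ext x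
    simp only [raise, lower, mem_insert, mem_erase, Nat.add_sub_cancel]
    constructor
    · rintro (rfl | ⟨h1, h2, h3 | h3⟩)
      · exact hm1
      · exact absurd h3 h1
      · exact h3.2
    · intro hx
      by_cases h1 : x = m + 1
      · exact Or.inl h1
      · exact Or.inr ⟨fun h => hm (h ▸ hx), fun h => h0 (h ▸ hx), Or.inr ⟨h1, hx⟩⟩

theorem raise_injOn {S : Finset ℕ} {m m' : ℕ} (hm : m + 1 ∉ S)
    (h : raise S m = raise S m') : m = m' := by
  have h1 : m + 1 ∈ raise S m' := h ▸ mem_insert_self _ _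
  simp only [raise, mem_insert, mem_erase] at h1
  rcases h1 with h1 | h1
  · omega
  · exact absurd h1.2 hm

/-- Reindexing of a sum over the strict partitions obtained by adding a box. -/
theorem sum_up {n : ℕ} (lam : Strict n) (F : Strict (n + 1) → ℝ) (G : ℕ → ℝ)
    (hF : ∀ nu, ¬ AddsBox lam nu → F nu = 0)
    (hG : ∀ m, m + 1 ∈ partSet lam → G m = 0)
    (hFG : ∀ m ∈ insert 0 (partSet lam), m + 1 ∉ partSet lam →
      ∀ nu, partSet nu = raise (partSet lam) m → F nu = G m) :
    ∑ nu, F nu = ∑ m ∈ insert 0 (partSet lam), G m := by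
  classical
  have hadd : ∀ nu, F nu ≠ 0 → AddsBox lam nu := fun nu h => by
    by_contra h'
    exact h (hF nu h')
  -- Only nonzero terms are matched: blocked rows have `G m = 0`, and partitions not obtained by
  -- adding a box have `F nu = 0`.
  refine sum_bij_ne_zero
    (fun nu _ h => (exists_raise_of_addsBox (hadd nu h)).choose) ?_ ?_ ?_ ?_
  · intro nu _ h
    exact (exists_raise_of_addsBox (hadd nu h)).choose_spec.1
  · intro nu _ h nu' _ h' heq
    have h1 := (exists_raise_of_addsBox (hadd nu h)).choose_spec.2.2
    have h2 := (exists_raise_of_addsBox (hadd nu' h')).choose_spec.2.2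
    apply partSet_injective
    rw [h1, h2, heq]
  · intro m hm hGm
    have hm1 : m + 1 ∉ partSet lam := fun h => hGm (hG m h)
    obtain ⟨nu, hnu⟩ : ∃ nu : Strict (n + 1), partSet nu = raise (partSet lam) m := by
      refine exists_partSet_eq (zero_notMem_raise (zero_notMem_partSet lam) m) ?_
      have h := sum_raise hm hm1 (f := fun k : ℕ => (k : ℝ)) (by simp)
      rw [sum_partSet_cast] at h
      push_cast at h
      have h' : ((∑ k ∈ raise (partSet lam) m, k : ℕ) : ℝ) = ((n + 1 : ℕ) : ℝ) := by
        push_cast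
        linarith
      exact_mod_cast h'
    have hFn := hFG m hm hm1 nu hnu
    have hne : F nu ≠ 0 := hFn ▸ hGm
    refine ⟨nu, mem_univ _, hne, ?_⟩
    have h1 := (exists_raise_of_addsBox (hadd nu hne)).choose_spec.2
    exact raise_injOn h1.1 (h1.2.symm.trans hnu)
  · intro nu _ h
    have h1 := (exists_raise_of_addsBox (hadd nu h)).choose_spec
    exact hFG _ h1.1 h1.2.1 nu h1.2.2

/-- Reindexing of a sum over the strict partitions obtained by removing a box. -/
theorem sum_down {n : ℕ} (nu : Strict (n + 1)) (F : Strict n → ℝ) (G : ℕ → ℝ)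
    (hF : ∀ mu, ¬ AddsBox mu nu → F mu = 0)
    (hG : ∀ m, m + 1 ∈ partSet nu → m ∈ partSet nu → G (m + 1) = 0)
    (hFG : ∀ m, m + 1 ∈ partSet nu → m ∉ partSet nu →
      ∀ mu, partSet mu = lower (partSet nu) (m + 1) → F mu = G (m + 1)) :
    ∑ mu, F mu = ∑ k ∈ partSet nu, G k := by
  classical
  have hadd : ∀ mu, F mu ≠ 0 → AddsBox mu nu := fun mu h => by
    by_contra h'
    exact h (hF mu h')
  have hspec : ∀ mu : Strict n, AddsBox mu nu → ∀ m, m ∈ insert 0 (partSet mu) ∧ m + 1 ∉ partSet mu ∧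
      partSet nu = raise (partSet mu) m → m + 1 ∈ partSet nu ∧ m ∉ partSet nu ∧
      partSet mu = lower (partSet nu) (m + 1) := by
    rintro mu - m ⟨h1, h2, h3⟩
    refine ⟨?_, ?_, ?_⟩
    · simp [h3, raise]
    · simp [h3, raise]
    · rw [h3, lower_raise (zero_notMem_partSet mu) h1 h2]
  refine sum_bij_ne_zero
    (fun mu _ h => (exists_raise_of_addsBox (hadd mu h)).choose + 1) ?_ ?_ ?_ ?_
  · intro mu _ h
    exact (hspec mu (hadd mu h) _ (exists_raise_of_addsBox (hadd mu h)).choose_spec).1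
  · intro mu _ h mu' _ h' heq
    have h1 := (hspec mu (hadd mu h) _ (exists_raise_of_addsBox (hadd mu h)).choose_spec).2.2
    have h2 := (hspec mu' (hadd mu' h') _ (exists_raise_of_addsBox (hadd mu' h')).choose_spec).2.2
    apply partSet_injective
    rw [h1, h2, heq]
  · intro k hk hGk
    have hnu0 := zero_notMem_partSet nu
    obtain ⟨m, rfl⟩ := Nat.exists_eq_succ_of_ne_zero (fun h : k = 0 => hnu0 (h ▸ hk))
    rw [Nat.succ_eq_add_one] at *
    have hm : m ∉ partSet nu := fun h => hGk (hG m hk h)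
    obtain ⟨mu, hmu⟩ : ∃ mu : Strict n, partSet mu = lower (partSet nu) (m + 1) := by
      refine exists_partSet_eq (zero_notMem_lower _ _) ?_
      have h := sum_lower hk (by simpa using hm) (f := fun k : ℕ => (k : ℝ)) (by simp)
      rw [sum_partSet_cast, Nat.add_sub_cancel] at h
      push_cast at h
      have h' : ((∑ k ∈ lower (partSet nu) (m + 1), k : ℕ) : ℝ) = (n : ℝ) := by
        push_cast
        linarith
      exact_mod_cast h'
    have hFn := hFG m hk hm mu hmu
    have hne : F mu ≠ 0 := hFn ▸ hGk
    refine ⟨mu, mem_univ _, hne, ?_⟩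
    have h1 := (exists_raise_of_addsBox (hadd mu hne)).choose_spec
    have h2 := raise_lower hnu0 hk hm
    rw [← hmu] at h2
    rw [raise_injOn h1.2.1 (h1.2.2.symm.trans h2.2.2.symm)]
  · intro mu _ h
    have h1 := hspec mu (hadd mu h) _ (exists_raise_of_addsBox (hadd mu h)).choose_spec
    exact hFG _ h1.1 h1.2.1 mu h1.2.2

/-! ### The hook formula and the transition probabilities -/

/-- The factor of the hook formula attached to an ordered pair of parts. -/
def pairFactor (i j : ℕ) : ℝ := if i < j then ((j : ℝ) - i) / (j + i) else 1

/-- The number of paths to the strict partition with set of parts `S`, divided by the factorial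
of its size. -/
def hookProd (S : Finset ℕ) : ℝ :=
  (∏ k ∈ S, (2 : ℝ) ^ (k - 1) / (k.factorial : ℝ)) * ∏ j ∈ S, ∏ i ∈ S, pairFactor i j

theorem pairFactor_pos (i j : ℕ) : 0 < pairFactor i j := by
  rw [pairFactor]
  split_ifs with h
  · have h' : (i : ℝ) < j := by exact_mod_cast h
    have h0 : (0 : ℝ) ≤ i := by positivity
    exact div_pos (by linarith) (by linarith)
  · exact one_pos

theorem hookProd_pos (S : Finset ℕ) : 0 < hookProd S :=
  mul_pos (prod_pos fun _ _ => by positivity)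
    (prod_pos fun _ _ => prod_pos fun _ _ => pairFactor_pos _ _)

theorem hookProd_insert {S : Finset ℕ} {a : ℕ} (ha : a ∉ S) :
    hookProd (insert a S) = hookProd S * ((2 : ℝ) ^ (a - 1) / (a.factorial : ℝ)) *
      ∏ i ∈ S, pairFactor i a * pairFactor a i := by
  have h1 : pairFactor a a = 1 := by simp [pairFactor]
  rw [hookProd, hookProd, prod_insert ha, prod_insert ha, prod_insert ha, h1,
    prod_congr rfl fun j _ => prod_insert ha, prod_mul_distrib, prod_mul_distrib]
  ring

/-- A phantom part `0` contributes `i / i = 1` for each pair and `2 ^ (0 - 1) / 0! = 1`, the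
subtraction being truncated. Removing the only box of a row is thus not a special case. -/
theorem hookProd_erase_zero (S : Finset ℕ) : hookProd (S.erase 0) = hookProd S := by
  by_cases h : 0 ∈ S
  · conv_rhs => rw [← insert_erase h]
    rw [hookProd_insert (notMem_erase 0 S), prod_eq_one]
    · simp
    · intro i hi
      have hi0 : (i : ℝ) ≠ 0 := by exact_mod_cast (mem_erase.1 hi).1
      have hpos : 0 < i := Nat.pos_of_ne_zero (mem_erase.1 hi).1
      simp [pairFactor, hpos, hi0]
  · rw [erase_eq_of_notMem h]

theorem downWeight_eq (S : Finset ℕ) (k : ℕ) :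
    downWeight S k =
      k * ∏ j ∈ S.erase k, (downNode k - upNode j) / (downNode k - downNode j) := by
  rw [downWeight, residue, show downNode k - upNode k = -2 * k by simp only [downNode, upNode]; ring]
  ring

/-- The node differences factor as `(m - i) (m + 1 + i)` and `(m + 1 - i) (m + i)`, exactly the
ratio of the pair factors before and after the move. -/
theorem pairFactor_shift {i m : ℕ} (hi : i ≠ 0) (him : i ≠ m) (him1 : i ≠ m + 1) :
    pairFactor i (m + 1) * pairFactor (m + 1) i *
        ((downNode (m + 1) - upNode i) / (downNode (m + 1) - downNode i)) =
      pairFactor i m * pairFactor m i := by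
  have hi' : (1 : ℝ) ≤ i := by exact_mod_cast Nat.one_le_iff_ne_zero.2 hi
  have hm' : (0 : ℝ) ≤ m := by positivity
  have h1 : (m : ℝ) + 1 - i ≠ 0 := by
    intro h
    apply him1
    have : (i : ℝ) = ((m + 1 : ℕ) : ℝ) := by push_cast; linarith
    exact_mod_cast this
  have h2 : (m : ℝ) + i ≠ 0 := by linarith
  have h3 : (m : ℝ) + 1 + i ≠ 0 := by linarith
  have h4 : (i : ℝ) + m ≠ 0 := by linarith
  have h5 : (i : ℝ) + (m + 1) ≠ 0 := by linarith
  have hratio : (downNode (m + 1) - upNode i) / (downNode (m + 1) - downNode i) =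
      (((m : ℝ) - i) * (m + 1 + i)) / ((m + 1 - i) * (m + i)) := by
    simp only [downNode, upNode]
    push_cast
    congr 1 <;> ring
  rw [hratio]
  rcases lt_or_gt_of_ne him with h | h
  · simp only [pairFactor, if_pos h, if_pos (show i < m + 1 by omega),
      if_neg (show ¬ m < i by omega), if_neg (show ¬ m + 1 < i by omega)]
    push_cast
    field_simp
  · simp only [pairFactor, if_pos h, if_pos (show m + 1 < i by omega),
      if_neg (show ¬ i < m by omega), if_neg (show ¬ i < m + 1 by omega)]
    push_cast
    field_simp
    ring

/-- The one-step ratio of the hook formula. It yields both the induction for `pathCount_eq` and the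
identification of the down probabilities with `downWeight`. -/
theorem hookProd_lower {S : Finset ℕ} (h0 : 0 ∉ S) {m : ℕ} (hm1 : m + 1 ∈ S) (hm : m ∉ S) :
    hookProd (lower S (m + 1)) * edgeMult m = hookProd S * downWeight S (m + 1) := by
  have hm' : m ∉ S.erase (m + 1) := fun h => hm (mem_of_mem_erase h)
  have hS : hookProd S = hookProd (insert (m + 1) (S.erase (m + 1))) := by rw [insert_erase hm1]
  rw [lower, hookProd_erase_zero, Nat.add_sub_cancel, hookProd_insert hm', hS,
    hookProd_insert (notMem_erase _ _), downWeight_eq, Nat.add_sub_cancel]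
  have hprod : ∏ i ∈ S.erase (m + 1), pairFactor i m * pairFactor m i =
      (∏ i ∈ S.erase (m + 1), pairFactor i (m + 1) * pairFactor (m + 1) i) *
        ∏ i ∈ S.erase (m + 1), (downNode (m + 1) - upNode i) / (downNode (m + 1) - downNode i) := by
    rw [← prod_mul_distrib]
    refine prod_congr rfl fun i hi => (pairFactor_shift ?_ ?_ ?_).symm
    · exact fun h => h0 (h ▸ mem_of_mem_erase hi)
    · exact fun h => hm' (h ▸ hi)
    · exact (mem_erase.1 hi).1
  -- For `m = 0` truncated subtraction gives `2 ^ (m - 1) = 1`, which matches the multiplicity one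
  -- of an edge opening a new row.
  have hpow : (2 : ℝ) ^ (m - 1) * edgeMult m = 2 ^ m := by
    rcases m with _ | m
    · simp [edgeMult]
    · simp [edgeMult, pow_succ]
  rw [hprod, Nat.factorial_succ, ← hpow]
  have hf : (m.factorial : ℝ) ≠ 0 := by positivity
  have hm2 : (m : ℝ) + 1 ≠ 0 := by positivity
  push_cast
  field_simp

theorem kappa_of_lower {n : ℕ} {mu : Strict n} {nu : Strict (n + 1)} {m : ℕ}
    (hm1 : m + 1 ∈ partSet nu) (hm : m ∉ partSet nu)
    (h : partSet mu = lower (partSet nu) (m + 1)) : kappa mu nu = edgeMult m := by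
  have h2 := raise_lower (zero_notMem_partSet nu) hm1 hm
  rw [← h] at h2
  exact kappa_of_raise h2.1 h2.2.1 h2.2.2.symm

/-- The hook formula for the number of paths in the Schur graph. -/
theorem pathCount_eq (n : ℕ) (lam : Strict n) :
    (pathCount n lam : ℝ) = n.factorial * hookProd (partSet lam) := by
  induction n with
  | zero =>
    have h : partSet lam = ∅ := by
      have h1 := sum_partSet lam
      rw [sum_eq_zero_iff] at h1
      refine eq_empty_of_forall_notMem fun k hk => zero_notMem_partSet lam ?_
      obtain rfl := h1 k hk
      exact hk
    simp [h, pathCount, hookProd]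
  | succ n ih =>
    have h0 := zero_notMem_partSet lam
    rw [pathCount]
    push_cast
    rw [sum_down lam _ fun k => n.factorial * (hookProd (partSet lam) * downWeight (partSet lam) k)]
    · rw [← mul_sum, ← mul_sum, sum_downWeight h0, sum_partSet_cast, Nat.factorial_succ]
      push_cast
      ring
    · intro mu h
      simp [kappa_eq_zero h]
    · intro m hm1 hm
      rw [downWeight_eq_zero h0 hm1 (by simpa using hm), mul_zero, mul_zero]
    · intro m hm1 hm mu hmu
      rw [ih, hmu, kappa_of_lower hm1 hm hmu, mul_assoc, hookProd_lower h0 hm1 hm]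

theorem pathCount_pos (n : ℕ) (lam : Strict n) : (0 : ℝ) < pathCount n lam := by
  rw [pathCount_eq]
  exact mul_pos (by positivity) (hookProd_pos _)

/-! ### Transition probabilities as residue weights -/

theorem pDown_of_lower {n : ℕ} {mu : Strict n} {nu : Strict (n + 1)} {m : ℕ}
    (hm1 : m + 1 ∈ partSet nu) (hm : m ∉ partSet nu)
    (h : partSet mu = lower (partSet nu) (m + 1)) :
    pDown nu mu = downWeight (partSet nu) (m + 1) / ((n : ℝ) + 1) := by
  have h1 := hookProd_lower (zero_notMem_partSet nu) hm1 hm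
  have h2 := hookProd_pos (partSet nu)
  have hf : (n.factorial : ℝ) ≠ 0 := by positivity
  have hn : (n : ℝ) + 1 ≠ 0 := by positivity
  rw [pDown, pathCount_eq, pathCount_eq, kappa_of_lower hm1 hm h, Nat.factorial_succ, h]
  push_cast
  field_simp
  linear_combination h1

theorem sum_pDown_mul {n : ℕ} (nu : Strict (n + 1)) (f : Gam) :
    ∑ mu, pDown nu mu * restrict n f mu = ev (partSet nu) (downOp f) / ((n : ℝ) + 1) := by
  have h0 := zero_notMem_partSet nu
  rw [ev_downOp h0, sum_div, sum_down nu]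
  · intro mu h
    simp [pDown, kappa_eq_zero h]
  · intro m hm1 hm
    rw [downWeight_eq_zero h0 hm1 (by simpa using hm), zero_mul, zero_div]
  · intro m hm1 hm mu hmu
    rw [pDown_of_lower hm1 hm hmu, restrict_apply, hmu]
    ring

/-- After the box is added, the down weight carries the reciprocal of the product in the up weight,
so only the local factor at `m` survives. That factor is the box factor of the multiplicative
measure times the edge multiplicity. -/
theorem upWeight_mul_downWeight (α : ℝ) {S : Finset ℕ} (h0 : 0 ∉ S) {m : ℕ}
    (hm : m ∈ insert 0 S) (hm1 : m + 1 ∉ S) :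
    upWeight α S m * downWeight (raise S m) (m + 1) = edgeMult m * (upNode m + α) := by
  have herase : (raise S m).erase (m + 1) = S.erase m := by
    rw [raise, erase_insert fun h => hm1 (mem_of_mem_erase h)]
  have hcancel : (∏ j ∈ S.erase m, (upNode m - downNode j) / (upNode m - upNode j)) *
      ∏ j ∈ S.erase m, (upNode m - upNode j) / (upNode m - downNode j) = 1 := by
    rw [← prod_mul_distrib]
    refine prod_eq_one fun j hj => ?_
    have hj' := mem_of_mem_erase hj
    have h1 : upNode m - upNode j ≠ 0 := fun h =>
      (mem_erase.1 hj).1 (upNode_injective (sub_eq_zero.1 h)).symm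
    have h2 : upNode m - downNode j ≠ 0 := fun h => by
      obtain ⟨j, rfl⟩ := Nat.exists_eq_succ_of_ne_zero (fun h : j = 0 => h0 (h ▸ hj'))
      rw [Nat.succ_eq_add_one, downNode_succ] at h
      exact hm1 (upNode_injective (sub_eq_zero.1 h) ▸ hj')
    field_simp
  have hzero : ∏ j ∈ S.erase m, (upNode m - upZero α j) / (upNode m - upNode j) =
      ∏ j ∈ S.erase m, (upNode m - downNode j) / (upNode m - upNode j) := by
    refine prod_congr rfl fun j hj => ?_
    have hj0 : j ≠ 0 := fun h => h0 (h ▸ mem_of_mem_erase hj)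
    rw [upZero, if_neg hj0]
  rw [downWeight_eq, herase, downNode_succ, upWeight, residue]
  by_cases hm0 : m = 0
  · subst hm0
    have h1 : (insert 0 S).erase 0 = S.erase 0 := by
      rw [erase_insert_eq_erase]
    rw [h1, hzero]
    simp only [edgeMult, upZero, if_true]
    push_cast
    linear_combination (upNode 0 + α) * hcancel
  · have hnode : upNode m ≠ 0 := by
      have h : (m : ℝ) ≠ 0 := by exact_mod_cast hm0
      rw [upNode]
      positivity
    rw [erase_insert_of_ne (Ne.symm hm0), prod_insert fun h => h0 (mem_of_mem_erase h), hzero,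
      edgeMult, if_neg hm0, upZero, if_neg hm0, upZero, if_pos rfl,
      show upNode 0 = 0 by simp [upNode]]
    have h2 : (upNode m - downNode m) * ((m + 1 : ℕ) : ℝ) = 2 * upNode m := by
      simp only [upNode, downNode]
      push_cast
      ring
    have h3 : (upNode m - -α) / (upNode m - 0) * upNode m = upNode m + α := by
      field_simp
      ring
    push_cast at *
    linear_combination (2 * (upNode m + α)) * hcancel +
      ((upNode m - -α) / (upNode m - 0) *
        ((∏ j ∈ S.erase m, (upNode m - downNode j) / (upNode m - upNode j)) *
          ∏ j ∈ S.erase m, (upNode m - upNode j) / (upNode m - downNode j))) * h2 +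
      (2 * ((∏ j ∈ S.erase m, (upNode m - downNode j) / (upNode m - upNode j)) *
          ∏ j ∈ S.erase m, (upNode m - upNode j) / (upNode m - downNode j))) * h3

theorem prod_diagram_of_raise {n k : ℕ} (α : ℝ) {lam : Strict n} {nu : Strict k} {m : ℕ}
    (hm : m ∈ insert 0 (partSet lam)) (hm1 : m + 1 ∉ partSet lam)
    (h : partSet nu = raise (partSet lam) m) :
    ∏ b ∈ diagram nu, (((b.2 : ℝ) - (b.1 : ℝ)) * ((b.2 : ℝ) - (b.1 : ℝ) + 1) + α) =
      (upNode m + α) *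
        ∏ b ∈ diagram lam, (((b.2 : ℝ) - (b.1 : ℝ)) * ((b.2 : ℝ) - (b.1 : ℝ) + 1) + α) := by
  obtain ⟨r, h1, h2⟩ := diagram_of_raise hm hm1 h
  rw [← h2, prod_insert h1, upNode]
  push_cast
  ring

theorem prod_diagram_pos {n : ℕ} {α : ℝ} (hα : 0 < α) (lam : Strict n) :
    0 < ∏ b ∈ diagram lam, (((b.2 : ℝ) - (b.1 : ℝ)) * ((b.2 : ℝ) - (b.1 : ℝ) + 1) + α) := by
  refine prod_pos fun b hb => ?_
  obtain ⟨k, -, c, -, rfl⟩ := (mem_diagram lam b).1 hb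
  push_cast
  rw [add_sub_cancel_left]
  positivity

/-- The ratio of measures involves the ratio of path counts, the factor of the new box, a power of
two and the normalization. The path ratio is a down weight, and `upWeight_mul_downWeight` turns the
product into an up weight. -/
theorem pUp_of_raise {n : ℕ} {α : ℝ} (hα : 0 < α) {lam : Strict n} {nu : Strict (n + 1)} {m : ℕ}
    (hm : m ∈ insert 0 (partSet lam)) (hm1 : m + 1 ∉ partSet lam)
    (h : partSet nu = raise (partSet lam) m) :
    pUp α lam nu = upWeight α (partSet lam) m / (2 * n + α) := by
  have h0 := zero_notMem_partSet lam
  have hlow : partSet lam = lower (partSet nu) (m + 1) := by rw [h, lower_raise h0 hm hm1]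
  have hmem : m + 1 ∈ partSet nu := by simp [h, raise]
  have hmem' : m ∉ partSet nu := by simp [h, raise]
  have hκ := kappa_of_raise hm hm1 h
  have hlen : len nu = len lam + if m = 0 then 1 else 0 := by
    rw [len_eq_card, len_eq_card, h, card_raise h0 hm hm1]
  -- A new row raises the length along with the size, leaving the power of two unchanged; otherwise
  -- the power halves and the multiplicity two compensates.
  have hpow : (edgeMult m : ℝ) * (2 : ℝ) ^ ((len nu : ℤ) - ((n + 1 : ℕ) : ℤ)) =
      2 ^ ((len lam : ℤ) - (n : ℤ)) := by
    have h2 : (2 : ℝ) ≠ 0 := two_ne_zero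
    rw [hlen, edgeMult]
    split_ifs
    · rw [Nat.cast_one, one_mul]
      congr 1
      push_cast
      ring
    · rw [Nat.cast_ofNat, ← zpow_one_add₀ h2]
      congr 1
      push_cast
      ring
  have hw := upWeight_mul_downWeight α h0 hm hm1
  have hd := pDown_of_lower hmem hmem' hlow
  rw [pDown, hκ] at hd
  rw [← h] at hw
  have hP := prod_diagram_pos hα lam
  have hQ : 0 < ∏ k ∈ range n, (α + 2 * (k : ℝ)) := prod_pos fun k _ => by positivity
  have hl := pathCount_pos n lam
  have hν := pathCount_pos (n + 1) nu
  have hz : (0 : ℝ) < (2 : ℝ) ^ ((len nu : ℤ) - ((n + 1 : ℕ) : ℤ)) := by positivity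
  have he : (0 : ℝ) < edgeMult m := by
    rw [edgeMult]
    split_ifs <;> norm_num
  have hf : (0 : ℝ) < n.factorial := by positivity
  have hn : (0 : ℝ) < (n : ℝ) + 1 := by positivity
  have hα2 : 0 < 2 * (n : ℝ) + α := by positivity
  rw [pUp, pDown, hκ, multMeasure, multMeasure, plancherel, plancherel,
    prod_diagram_of_raise α hm hm1 h, ← hpow, prod_range_succ, Nat.factorial_succ]
  generalize (∏ b ∈ diagram lam, (((b.2 : ℝ) - (b.1 : ℝ)) * ((b.2 : ℝ) - (b.1 : ℝ) + 1) + α)) = P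
    at *
  generalize (∏ k ∈ range n, (α + 2 * (k : ℝ))) = Q at *
  generalize (2 : ℝ) ^ ((len nu : ℤ) - ((n + 1 : ℕ) : ℤ)) = z at *
  generalize (pathCount n lam : ℝ) = a at *
  generalize (pathCount (n + 1) nu : ℝ) = b at *
  generalize upWeight α (partSet lam) m = w at *
  generalize downWeight (partSet nu) (m + 1) = d at *
  generalize (edgeMult m : ℝ) = e at *
  have hd' : d = (n + 1) * (a / b * e) := by
    rw [hd]
    field_simp
  have hw' : upNode m + α = w * ((n + 1) * (a / b)) := by
    rw [hd'] at hw
    have : e * (upNode m + α) = e * (w * ((n + 1) * (a / b))) := by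
      rw [← hw]
      ring
    exact mul_left_cancel₀ he.ne' this
  rw [hw', add_comm α]
  push_cast
  field_simp

theorem sum_pUp_mul {n : ℕ} {α : ℝ} (hα : 0 < α) (lam : Strict n) (f : Gam) :
    ∑ nu : Strict (n + 1), pUp α lam nu * ev (partSet nu) f =
      ev (partSet lam) (upOp α f) / (2 * n + α) := by
  rw [ev_upOp α (zero_notMem_partSet lam), sum_div, sum_up lam]
  · intro nu h
    simp [pUp, pDown, kappa_eq_zero h]
  · intro m hm
    rw [upWeight_eq_zero α hm, zero_mul, zero_div]
  · intro m hm hm1 nu hnu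
    rw [pUp_of_raise hα hm hm1 hnu, hnu]
    ring

/-- The transition operator of the up/down chain as the composition of the up and down operators
on `Γ`. -/
theorem T_restrict {n : ℕ} {α : ℝ} (hα : 0 < α) (f : Gam) (lam : Strict n) :
    T α n (restrict n f) lam =
      ev (partSet lam) (upOp α (downOp f)) / ((2 * n + α) * ((n : ℝ) + 1)) := by
  rw [T, Matrix.mulVecLin_apply, Matrix.mulVec, dotProduct]
  simp only [upDownMatrix, sum_mul]
  rw [sum_comm]
  have h : ∀ nu : Strict (n + 1),
      ∑ mu, pUp α lam nu * pDown nu mu * restrict n f mu =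
        pUp α lam nu * ev (partSet nu) (downOp f) / ((n : ℝ) + 1) := by
    intro nu
    simp only [mul_assoc]
    rw [← mul_sum, sum_pDown_mul, mul_div_assoc]
  rw [sum_congr rfl fun nu _ => h nu, ← sum_div, sum_pUp_mul hα, div_div]

/-! ### The degree filtration -/

/-- The elements of `Γ` of degree at most `m`. -/
def Fil (m : ℤ) : Submodule ℝ Gam :=
  MvPolynomial.restrictSupport ℝ {d | Finsupp.weight wt d ≤ m}

theorem mem_Fil {m : ℤ} {f : Gam} :
    f ∈ Fil m ↔ ∀ d, MvPolynomial.coeff d f ≠ 0 → Finsupp.weight wt d ≤ m := by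
  rw [Fil, MvPolynomial.mem_restrictSupport_iff]
  simp only [Set.subset_def, mem_coe, MvPolynomial.mem_support_iff, Set.mem_ofPred_eq]

theorem mem_Fil_iff_deg {m : ℤ} {f : Gam} : f ∈ Fil m ↔ deg f ≤ m := by
  rw [mem_Fil, deg, MvPolynomial.weightedTotalDegree', Finset.sup_le_iff]
  simp only [MvPolynomial.mem_support_iff, WithBot.coe_le_coe]

theorem Fil_mono {m m' : ℤ} (h : m ≤ m') {f : Gam} (hf : f ∈ Fil m) : f ∈ Fil m' :=
  mem_Fil.2 fun d hd => (mem_Fil.1 hf d hd).trans h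

theorem mul_mem_Fil {a b c : ℤ} {f g : Gam} (hf : f ∈ Fil a) (hg : g ∈ Fil b) (h : a + b ≤ c) :
    f * g ∈ Fil c := by
  classical
  refine mem_Fil.2 fun d hd => ?_
  rw [MvPolynomial.coeff_mul] at hd
  obtain ⟨x, hx, hne⟩ := exists_ne_zero_of_sum_ne_zero hd
  have h1 := mem_Fil.1 hf x.1 (left_ne_zero_of_mul hne)
  have h2 := mem_Fil.1 hg x.2 (right_ne_zero_of_mul hne)
  rw [← mem_antidiagonal.1 hx, map_add]
  linarith

theorem mem_Fil_of_isWeightedHomogeneous {m : ℤ} {f : Gam}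
    (h : MvPolynomial.IsWeightedHomogeneous wt f m) : f ∈ Fil m :=
  mem_Fil.2 fun _ hd => (h hd).le

theorem p_mem_Fil (i : ℕ) : p i ∈ Fil (2 * (i : ℤ) + 1) :=
  mem_Fil_of_isWeightedHomogeneous (MvPolynomial.isWeightedHomogeneous_X ℝ wt i)

theorem algebraMap_mem_Fil (c : ℝ) : algebraMap ℝ Gam c ∈ Fil 0 :=
  mem_Fil_of_isWeightedHomogeneous (MvPolynomial.isWeightedHomogeneous_C wt c)

theorem weight_nonneg (d : ℕ →₀ ℕ) : 0 ≤ Finsupp.weight wt d := by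
  rw [Finsupp.weight_apply]
  exact sum_nonneg fun i _ => nsmul_nonneg (by simp only [wt]; positivity) _

theorem eq_zero_of_mem_Fil {m : ℤ} (hm : m < 0) {f : Gam} (hf : f ∈ Fil m) : f = 0 := by
  ext d
  by_contra h
  have := mem_Fil.1 hf d h
  have := weight_nonneg d
  omega

theorem exists_mem_Fil (f : Gam) : ∃ m : ℕ, f ∈ Fil m := by
  refine ⟨f.support.sup fun d => (Finsupp.weight wt d).toNat, mem_Fil.2 fun d hd => ?_⟩
  have h := le_sup (f := fun d => (Finsupp.weight wt d).toNat) (MvPolynomial.mem_support_iff.2 hd)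
  have := weight_nonneg d
  omega

theorem weight_add_single (d : ℕ →₀ ℕ) (i : ℕ) :
    Finsupp.weight wt (d + Finsupp.single i 1) = Finsupp.weight wt d + (2 * (i : ℤ) + 1) := by
  rw [map_add, Finsupp.weight_single, one_smul, wt]

theorem dp_mem_Fil {m : ℤ} {f : Gam} (hf : f ∈ Fil m) (i : ℕ) :
    dp i f ∈ Fil (m - (2 * (i : ℤ) + 1)) := by
  refine mem_Fil.2 fun d hd => ?_
  have hd' : MvPolynomial.coeff (d + Finsupp.single i 1) f * (d i + 1) ≠ 0 := by
    rw [← MvPolynomial.coeff_pderiv]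
    exact hd
  have h := mem_Fil.1 hf _ (left_ne_zero_of_mul hd')
  rw [weight_add_single] at h
  linarith

theorem dp_mul (i : ℕ) (f g : Gam) : dp i (f * g) = dp i f * g + f * dp i g :=
  MvPolynomial.pderiv_mul

theorem dp_p (i j : ℕ) : dp i (p j) = if i = j then 1 else 0 := by
  change MvPolynomial.pderiv i (MvPolynomial.X j) = _
  split_ifs with h
  · rw [h, MvPolynomial.pderiv_X_self]
  · rw [MvPolynomial.pderiv_X_of_ne (Ne.symm h)]

theorem dp_mul_p (i n : ℕ) (f : Gam) :
    dp i (f * p n) = dp i f * p n + if i = n then f else 0 := by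
  rw [dp_mul, dp_p, mul_ite, mul_one, mul_zero]

/-- The elements of `Γ[t]` of degree at most `m`, where `t` has degree two. -/
def FilT (m : ℤ) : Submodule ℝ (Polynomial Gam) where
  carrier := {P | ∀ k : ℕ, P.coeff k ∈ Fil (m - 2 * k)}
  add_mem' hP hQ k := by
    rw [Polynomial.coeff_add]
    exact add_mem (hP k) (hQ k)
  zero_mem' k := by simp
  smul_mem' c P hP k := by
    rw [Polynomial.coeff_smul]
    exact Submodule.smul_mem _ _ (hP k)

theorem mul_mem_FilT {a b c : ℤ} {P Q : Polynomial Gam} (hP : P ∈ FilT a) (hQ : Q ∈ FilT b)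
    (h : a + b ≤ c) : P * Q ∈ FilT c := by
  intro k
  rw [Polynomial.coeff_mul]
  refine sum_mem fun x hx => mul_mem_Fil (hP x.1) (hQ x.2) ?_
  have := mem_antidiagonal.1 hx
  omega

theorem FilT_mono {m m' : ℤ} (h : m ≤ m') {P : Polynomial Gam} (hP : P ∈ FilT m) : P ∈ FilT m' :=
  fun k => Fil_mono (by omega) (hP k)

theorem monomial_mem_FilT {m : ℤ} {i : ℕ} {f : Gam} (hf : f ∈ Fil (m - 2 * i)) :
    Polynomial.monomial i f ∈ FilT m := by
  intro k
  rw [Polynomial.coeff_monomial]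
  split_ifs with h
  · rw [← h]
    exact hf
  · exact zero_mem _

theorem C_mem_FilT {m : ℤ} {f : Gam} (hf : f ∈ Fil m) : Polynomial.C f ∈ FilT m :=
  monomial_mem_FilT (i := 0) (by simpa using hf)

theorem momentMap_eq_sum (a : ℕ → Gam) (P : Polynomial Gam) :
    momentMap a P = ∑ k ∈ P.support, P.coeff k * a k := by
  conv_lhs => rw [P.as_sum_support, map_sum]
  exact sum_congr rfl fun k _ => momentMap_monomial a k _

theorem momentMap_mem_Fil {a : ℕ → Gam} {s m c : ℤ} (ha : ∀ k : ℕ, a k ∈ Fil (2 * k + s))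
    {P : Polynomial Gam} (hP : P ∈ FilT m) (h : m + s ≤ c) : momentMap a P ∈ Fil c := by
  rw [momentMap_eq_sum]
  exact sum_mem fun k _ => mul_mem_Fil (hP k) (ha k) (by omega)

theorem momentMap_add (a b : ℕ → Gam) (P : Polynomial Gam) :
    momentMap (fun k => a k + b k) P = momentMap a P + momentMap b P := by
  simp only [momentMap_eq_sum, mul_add, sum_add_distrib]

theorem momentMap_smul (c : ℝ) (a : ℕ → Gam) (P : Polynomial Gam) :
    momentMap (fun k => c • a k) P = c • momentMap a P := by
  simp only [momentMap_eq_sum, mul_smul_comm, smul_sum]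

theorem momentMap_C (a : ℕ → Gam) (f : Gam) : momentMap a (Polynomial.C f) = f * a 0 :=
  momentMap_monomial a 0 f

theorem momentMap_real_smul (a : ℕ → Gam) (c : ℝ) (P : Polynomial Gam) :
    momentMap a (c • P) = c • momentMap a P :=
  ((momentMap a).restrictScalars ℝ).map_smul c P

/-! ### The Taylor expansion up to terms of degree three -/

/-- The leading coefficients satisfy `2 (2 i + 3) - (2 i + 1) = 2 i + 5`, in accordance with the
recurrence. -/
theorem degree_shiftPoly_sub_lt (i : ℕ) :
    (shiftPoly i - Polynomial.monomial i (2 * (i : ℝ) + 1)).degree < i := by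
  induction i using Nat.twoStepInduction with
  | zero => simp [shiftPoly]
  | one =>
    have h : shiftPoly 1 - Polynomial.monomial 1 (2 * ((1 : ℕ) : ℝ) + 1) = 1 := by
      rw [shiftPoly, ← Polynomial.C_mul_X_pow_eq_monomial, pow_one]
      norm_num
      rw [map_ofNat]
      ring
    rw [h, Polynomial.degree_one]
    norm_num
  | more i h0 h1 =>
    have h : shiftPoly (i + 2) - Polynomial.monomial (i + 2) (2 * ((i + 2 : ℕ) : ℝ) + 1) =
        2 * Polynomial.X *
            (shiftPoly (i + 1) - Polynomial.monomial (i + 1) (2 * ((i + 1 : ℕ) : ℝ) + 1)) +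
          (shiftPoly (i + 1) - Polynomial.monomial (i + 1) (2 * ((i + 1 : ℕ) : ℝ) + 1)) +
          Polynomial.monomial (i + 1) (2 * ((i + 1 : ℕ) : ℝ) + 1) -
          Polynomial.X ^ 2 * (shiftPoly i - Polynomial.monomial i (2 * (i : ℝ) + 1)) := by
      simp only [shiftPoly, ← Polynomial.C_mul_X_pow_eq_monomial, map_add, map_mul,
        Polynomial.C_ofNat, map_one, map_natCast]
      push_cast
      ring
    rw [h]
    rw [Polynomial.degree_lt_iff_coeff_zero] at h0 h1 ⊢
    intro k hk
    obtain ⟨k, rfl⟩ := Nat.exists_eq_add_of_le' (show 2 ≤ k by omega)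
    have e1 := h1 (k + 1) (by omega)
    have e2 := h1 (k + 2) (by omega)
    have e3 := h0 k (by omega)
    rw [Polynomial.coeff_sub, Polynomial.coeff_add, Polynomial.coeff_add, Polynomial.coeff_X_pow_mul,
      mul_assoc, Polynomial.coeff_ofNat_mul, Polynomial.coeff_X_mul, e1, e2, e3,
      Polynomial.coeff_monomial, if_neg (by omega)]
    simp

theorem map_shiftPoly_sub_mem_FilT (i : ℕ) :
    (shiftPoly i).map (algebraMap ℝ Gam) - Polynomial.monomial i (algebraMap ℝ Gam (2 * i + 1)) ∈
      FilT (2 * i - 2) := by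
  intro k
  rw [← Polynomial.map_monomial, ← Polynomial.map_sub, Polynomial.coeff_map]
  by_cases hk : i ≤ k
  · rw [(Polynomial.degree_lt_iff_coeff_zero _ _).1 (degree_shiftPoly_sub_lt i) k hk, map_zero]
    exact zero_mem _
  · exact Fil_mono (by omega) (algebraMap_mem_Fil _)

/-- The first order term of the Taylor expansion. -/
def firstOrder (N : ℕ) : Gam →ₗ[ℝ] Polynomial Gam :=
  ∑ i ∈ range N, (2 * (i : ℝ) + 1) • ((Polynomial.monomial i).restrictScalars ℝ ∘ₗ dp i)

/-- Twice the second order term of the Taylor expansion. -/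
def secondOrder (N : ℕ) : Gam →ₗ[ℝ] Polynomial Gam :=
  ∑ i ∈ range N, ∑ j ∈ range N, ((2 * (i : ℝ) + 1) * (2 * (j : ℝ) + 1)) •
    ((Polynomial.monomial (i + j)).restrictScalars ℝ ∘ₗ dp i ∘ₗ dp j)

theorem firstOrder_apply (N : ℕ) (f : Gam) :
    firstOrder N f = ∑ i ∈ range N, (2 * (i : ℝ) + 1) • Polynomial.monomial i (dp i f) := by
  simp [firstOrder, LinearMap.sum_apply]

theorem secondOrder_apply (N : ℕ) (f : Gam) :
    secondOrder N f = ∑ i ∈ range N, ∑ j ∈ range N, ((2 * (i : ℝ) + 1) * (2 * (j : ℝ) + 1)) •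
      Polynomial.monomial (i + j) (dp i (dp j f)) := by
  simp [secondOrder, LinearMap.sum_apply]

theorem firstOrder_mul_p {N n : ℕ} (hn : n < N) (f : Gam) :
    firstOrder N (f * p n) = firstOrder N f * Polynomial.C (p n) +
      (2 * (n : ℝ) + 1) • Polynomial.monomial n f := by
  simp only [firstOrder_apply, dp_mul_p, map_add, smul_add, sum_add_distrib]
  congr 1
  · rw [sum_mul]
    refine sum_congr rfl fun i _ => ?_
    rw [smul_mul_assoc, Polynomial.monomial_mul_C]
  · rw [sum_eq_single n]
    · simp
    · intro i _ hi
      simp [hi]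
    · intro h
      exact absurd (mem_range.2 hn) h

theorem secondOrder_mul_p {N n : ℕ} (hn : n < N) (f : Gam) :
    secondOrder N (f * p n) = secondOrder N f * Polynomial.C (p n) +
      (2 * (2 * (n : ℝ) + 1)) • (Polynomial.monomial n 1 * firstOrder N f) := by
  have hdp : ∀ i j, dp i (dp j (f * p n)) = dp i (dp j f) * p n +
      (if i = n then dp j f else 0) + if j = n then dp i f else 0 := by
    intro i j
    rw [dp_mul_p, map_add, dp_mul_p, apply_ite (dp i), map_zero]
  have h1 : ∑ i ∈ range N, ∑ j ∈ range N, ((2 * (i : ℝ) + 1) * (2 * (j : ℝ) + 1)) •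
      Polynomial.monomial (i + j) (if i = n then dp j f else 0) =
      (2 * (n : ℝ) + 1) • (Polynomial.monomial n 1 * firstOrder N f) := by
    rw [sum_eq_single n]
    · simp only [if_true, firstOrder_apply, mul_sum, smul_sum]
      refine sum_congr rfl fun j _ => ?_
      rw [mul_smul_comm, Polynomial.monomial_mul_monomial, one_mul, smul_smul]
    · intro i _ hi
      simp [hi]
    · intro h
      exact absurd (mem_range.2 hn) h
  have h2 : ∑ i ∈ range N, ∑ j ∈ range N, ((2 * (i : ℝ) + 1) * (2 * (j : ℝ) + 1)) •
      Polynomial.monomial (i + j) (if j = n then dp i f else 0) =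
      (2 * (n : ℝ) + 1) • (Polynomial.monomial n 1 * firstOrder N f) := by
    rw [← h1, sum_comm]
    refine sum_congr rfl fun i _ => sum_congr rfl fun j _ => ?_
    rw [add_comm j i, mul_comm (2 * (j : ℝ) + 1)]
  simp only [secondOrder_apply, hdp, map_add, smul_add, sum_add_distrib]
  rw [h1, h2, sum_mul, mul_comm 2, add_assoc, ← two_smul ℝ, smul_smul, mul_comm 2]
  congr 1
  refine sum_congr rfl fun i _ => ?_
  rw [sum_mul]
  refine sum_congr rfl fun j _ => ?_
  rw [smul_mul_assoc, Polynomial.monomial_mul_C]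

theorem firstOrder_mem_FilT (N : ℕ) {m : ℤ} {f : Gam} (hf : f ∈ Fil m) :
    firstOrder N f ∈ FilT (m - 1) := by
  rw [firstOrder_apply]
  refine sum_mem fun i _ => Submodule.smul_mem _ _ (monomial_mem_FilT ?_)
  exact Fil_mono (by omega) (dp_mem_Fil hf i)

theorem secondOrder_mem_FilT (N : ℕ) {m : ℤ} {f : Gam} (hf : f ∈ Fil m) :
    secondOrder N f ∈ FilT (m - 2) := by
  rw [secondOrder_apply]
  refine sum_mem fun i _ => sum_mem fun j _ => Submodule.smul_mem _ _ (monomial_mem_FilT ?_)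
  exact Fil_mono (by push_cast; omega) (dp_mem_Fil (dp_mem_Fil hf j) i)

/-- The remainder of the Taylor expansion of second order. -/
def remainder (s : ℝ) (N : ℕ) : Gam →ₗ[ℝ] Polynomial Gam :=
  (taylor s).toLinearMap - ((Polynomial.CAlgHom (R := ℝ) (A := Gam)).toLinearMap + s • firstOrder N +
    (1 / 2 : ℝ) • secondOrder N)

theorem taylor_eq (s : ℝ) (N : ℕ) (f : Gam) :
    taylor s f = Polynomial.C f + s • firstOrder N f + (1 / 2 : ℝ) • secondOrder N f +
      remainder s N f := by
  simp [remainder]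

/-- `taylor s` is multiplicative and its quadratic truncation is not; the last two terms measure the
defect. The condition `s * s = 1` allows the second order coefficient to be `1 / 2` for both signs.
This is the inductive step of the degree bound. -/
theorem remainder_mul_p {s : ℝ} (hs : s * s = 1) {N n : ℕ} (hn : n < N) (f : Gam) :
    remainder s N (f * p n) = remainder s N f * taylor s (p n) +
      s • (((shiftPoly n).map (algebraMap ℝ Gam) -
          Polynomial.monomial n (algebraMap ℝ Gam (2 * n + 1))) *
        (Polynomial.C f + s • firstOrder N f + (1 / 2 : ℝ) • secondOrder N f)) +
      (s / 2) • (Polynomial.monomial n (algebraMap ℝ Gam (2 * n + 1)) * secondOrder N f) := by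
  have h1 := taylor_eq s N (f * p n)
  rw [map_mul, taylor_eq s N f, firstOrder_mul_p hn, secondOrder_mul_p hn] at h1
  have hp : taylor s (p n) = Polynomial.C (p n) +
      (s • shiftPoly n).map (algebraMap ℝ Gam) := by
    rw [taylor, p, MvPolynomial.aeval_X, p]
  rw [Polynomial.map_smul] at hp
  rw [hp] at h1 ⊢
  have hm : Polynomial.monomial n f = Polynomial.monomial n 1 * Polynomial.C f := by
    rw [Polynomial.monomial_mul_C, one_mul]
  have hm2 : Polynomial.monomial n (algebraMap ℝ Gam (2 * n + 1)) =
      (2 * (n : ℝ) + 1) • Polynomial.monomial n (1 : Gam) := by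
    rw [Polynomial.smul_monomial, Algebra.algebraMap_eq_smul_one]
  have hsc : ∀ (c : ℝ) (P : Polynomial Gam), c • P = algebraMap ℝ (Polynomial Gam) c * P :=
    fun c P => Algebra.smul_def c P
  have hsc2 : ∀ (c : ℝ) (P : Polynomial Gam),
      algebraMap ℝ Gam c • P = algebraMap ℝ (Polynomial Gam) c * P := fun c P => by
    rw [algebraMap_smul, Algebra.smul_def]
  have hs' : algebraMap ℝ (Polynomial Gam) s * algebraMap ℝ (Polynomial Gam) s = 1 := by
    rw [← map_mul, hs, map_one]
  have h2 : algebraMap ℝ (Polynomial Gam) (1 / 2) * 2 = 1 := by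
    rw [← map_ofNat (algebraMap ℝ (Polynomial Gam)) 2, ← map_mul]
    norm_num
  rw [hm2]
  rw [hm] at h1
  have hd : s / 2 = s * (1 / 2) := by ring
  rw [hd]
  simp only [hsc, hsc2, map_mul, map_ofNat] at h1 ⊢
  linear_combination (-1 : Polynomial Gam) * h1 +
    (firstOrder N f * algebraMap ℝ (Polynomial Gam) (2 * n + 1) * Polynomial.monomial n 1) *
      (hs' - h2)

theorem taylor_p_mem_FilT (s : ℝ) (n : ℕ) : taylor s (p n) ∈ FilT (2 * n + 1) := by
  have hp : taylor s (p n) = Polynomial.C (p n) +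
      s • (((shiftPoly n).map (algebraMap ℝ Gam) -
          Polynomial.monomial n (algebraMap ℝ Gam (2 * n + 1))) +
        Polynomial.monomial n (algebraMap ℝ Gam (2 * n + 1))) := by
    rw [sub_add_cancel, taylor, p, MvPolynomial.aeval_X, p, Polynomial.map_smul, algebraMap_smul]
  rw [hp]
  refine add_mem (C_mem_FilT (p_mem_Fil n)) (Submodule.smul_mem _ _ (add_mem ?_ ?_))
  · exact FilT_mono (by omega) (map_shiftPoly_sub_mem_FilT n)
  · exact monomial_mem_FilT (Fil_mono (by omega) (algebraMap_mem_Fil _))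

/-- Lets the induction strip one variable at a time: if `n` is not below `N`, then `∂ (f p_{2n+1}) /
∂p_{2n+1}` multiplies each coefficient of `f` by a positive integer, so its vanishing forces `f =
0`. -/
theorem dp_eq_zero_of_mul_p {N n : ℕ} {f : Gam} (h : ∀ i, N ≤ i → dp i (f * p n) = 0) :
    f = 0 ∨ (n < N ∧ ∀ i, N ≤ i → dp i f = 0) := by
  by_cases hn : n < N
  · refine Or.inr ⟨hn, fun i hi => ?_⟩
    have h1 := h i hi
    rw [dp_mul_p, if_neg (by omega), add_zero] at h1
    exact (mul_eq_zero.1 h1).resolve_right (MvPolynomial.X_ne_zero n)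
  · refine Or.inl ?_
    ext d
    have h1 : MvPolynomial.coeff d (MvPolynomial.pderiv n (f * MvPolynomial.X n)) = 0 := by
      have := h n (not_lt.1 hn)
      change MvPolynomial.pderiv n (f * MvPolynomial.X n) = 0 at this
      rw [this, MvPolynomial.coeff_zero]
    rw [MvPolynomial.coeff_pderiv, MvPolynomial.coeff_mul_X] at h1
    rw [MvPolynomial.coeff_zero]
    exact (mul_eq_zero.1 h1).resolve_right (by positivity)

theorem mem_Fil_of_mul_p {m : ℤ} {n : ℕ} {f : Gam} (h : f * p n ∈ Fil m) :
    f ∈ Fil (m - (2 * n + 1)) := by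
  refine mem_Fil.2 fun d hd => ?_
  have h1 := mem_Fil.1 h (d + Finsupp.single n 1) (by rwa [p, MvPolynomial.coeff_mul_X])
  rw [weight_add_single] at h1
  linarith

/-- Replacing `p_{2i+1}` by `t ^ i` lowers the degree by one, and the remainder collects at least
three such losses; the lower terms of `shiftPoly` lose three degrees at once. -/
theorem remainder_monomial_mem_FilT {s : ℝ} (hs : s * s = 1) (N : ℕ) (d : ℕ →₀ ℕ) (c : ℝ) :
    ∀ m : ℤ, MvPolynomial.monomial d c ∈ Fil m →
      (∀ i, N ≤ i → dp i (MvPolynomial.monomial d c) = 0) →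
      remainder s N (MvPolynomial.monomial d c) ∈ FilT (m - 3) := by
  refine MvPolynomial.induction_on_monomial (motive := fun f : Gam => ∀ m : ℤ, f ∈ Fil m →
      (∀ i, N ≤ i → dp i f = 0) → remainder s N f ∈ FilT (m - 3)) ?_ ?_ d c
  · intro a m _ _
    have hdp : ∀ i, dp i (MvPolynomial.C a) = 0 := fun i => MvPolynomial.pderiv_C
    have h := taylor_eq s N (MvPolynomial.C a)
    have h2 : taylor s (MvPolynomial.C a) = Polynomial.C (MvPolynomial.C a) := by
      rw [← MvPolynomial.algebraMap_eq, AlgHom.commutes, Polynomial.algebraMap_apply]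
    rw [h2, firstOrder_apply, secondOrder_apply] at h
    simp only [hdp, map_zero, smul_zero, sum_const_zero, add_zero] at h
    rw [left_eq_add.1 h]
    exact zero_mem _
  · intro f n ih m hm hdp
    change remainder s N (f * p n) ∈ _
    rcases dp_eq_zero_of_mul_p hdp with rfl | ⟨hn, hdp'⟩
    · rw [zero_mul, map_zero]
      exact zero_mem _
    · have hf := mem_Fil_of_mul_p hm
      have h1 := firstOrder_mem_FilT N hf
      have h2 := secondOrder_mem_FilT N hf
      rw [remainder_mul_p hs hn]
      refine add_mem (add_mem ?_ (Submodule.smul_mem _ _ ?_)) (Submodule.smul_mem _ _ ?_)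
      · exact mul_mem_FilT (ih _ hf hdp') (taylor_p_mem_FilT s n) (by omega)
      · refine mul_mem_FilT (map_shiftPoly_sub_mem_FilT n) (b := m - (2 * n + 1))
          (add_mem (add_mem ?_ (Submodule.smul_mem _ _ ?_)) (Submodule.smul_mem _ _ ?_)) (by omega)
        · exact C_mem_FilT hf
        · exact FilT_mono (by omega) h1
        · exact FilT_mono (by omega) h2
      · exact mul_mem_FilT (a := 2 * n)
          (monomial_mem_FilT (Fil_mono (by omega) (algebraMap_mem_Fil _))) h2 (by omega)

theorem coeff_eq_zero_of_dp_eq_zero {i : ℕ} {f : Gam} (h : dp i f = 0) {d : ℕ →₀ ℕ}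
    (hd : MvPolynomial.coeff d f ≠ 0) : d i = 0 := by
  by_contra hdi
  have hle : Finsupp.single i 1 ≤ d := by
    rw [Finsupp.single_le_iff]
    omega
  have h1 : MvPolynomial.coeff (d - Finsupp.single i 1) (MvPolynomial.pderiv i f) = 0 := by
    change MvPolynomial.coeff _ (dp i f) = 0
    rw [h, MvPolynomial.coeff_zero]
  rw [MvPolynomial.coeff_pderiv, tsub_add_cancel_of_le hle] at h1
  exact hd ((mul_eq_zero.1 h1).resolve_right (by positivity))

theorem remainder_mem_FilT {s : ℝ} (hs : s * s = 1) (N : ℕ) {m : ℤ} {f : Gam} (hf : f ∈ Fil m)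
    (hdp : ∀ i, N ≤ i → dp i f = 0) : remainder s N f ∈ FilT (m - 3) := by
  rw [f.as_sum, map_sum]
  refine sum_mem fun d hd => remainder_monomial_mem_FilT hs N d _ m ?_ ?_
  · have hd' := mem_Fil.1 hf d (MvPolynomial.mem_support_iff.1 hd)
    exact (MvPolynomial.monomial_mem_restrictSupport ℝ).2 (Or.inl hd')
  · intro i hi
    change MvPolynomial.pderiv i _ = 0
    rw [MvPolynomial.pderiv_monomial,
      coeff_eq_zero_of_dp_eq_zero (hdp i hi) (MvPolynomial.mem_support_iff.1 hd)]
    simp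

theorem momentMap_taylor {s : ℝ} (hs : s * s = 1) {a a₁ a₀ a' : ℕ → Gam}
    (ha : ∀ k, a k = a₁ k + a₀ k + a' k) (h₁ : ∀ k : ℕ, a₁ k ∈ Fil (2 * k + 1))
    (h₀ : ∀ k : ℕ, a₀ k ∈ Fil (2 * k + 0)) (h' : ∀ k : ℕ, a' k ∈ Fil (2 * k + -1))
    {N : ℕ} {m : ℤ} {f : Gam} (hf : f ∈ Fil m) (hdp : ∀ i, N ≤ i → dp i f = 0) :
    momentMap a (taylor s f) - (f * a₁ 0 + f * a₀ 0 + s • momentMap a₁ (firstOrder N f) +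
      (1 / 2 : ℝ) • momentMap a₁ (secondOrder N f) + s • momentMap a₀ (firstOrder N f)) ∈
      Fil (m - 2) := by
  -- The term `f * a' 0` would have relative degree `-1`, too large to discard, but an element of
  -- negative degree is zero.
  have ha0 : a' 0 = 0 := eq_zero_of_mem_Fil (by norm_num) (h' 0)
  have e1 := firstOrder_mem_FilT N hf
  have e2 := secondOrder_mem_FilT N hf
  have e3 := remainder_mem_FilT hs N hf hdp
  have key : momentMap a (taylor s f) - (f * a₁ 0 + f * a₀ 0 + s • momentMap a₁ (firstOrder N f) +
      (1 / 2 : ℝ) • momentMap a₁ (secondOrder N f) + s • momentMap a₀ (firstOrder N f)) =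
      momentMap a₁ (remainder s N f) + momentMap a₀ (remainder s N f) +
        momentMap a' (remainder s N f) + (1 / 2 : ℝ) • momentMap a₀ (secondOrder N f) +
        (1 / 2 : ℝ) • momentMap a' (secondOrder N f) + s • momentMap a' (firstOrder N f) := by
    rw [taylor_eq s N f, show a = fun k => a₁ k + a₀ k + a' k from funext ha, momentMap_add,
      momentMap_add]
    simp only [map_add, momentMap_C, momentMap_real_smul, ha0]
    ring
  rw [key]
  refine add_mem (add_mem (add_mem (add_mem (add_mem ?_ ?_) ?_) (Submodule.smul_mem _ _ ?_))
    (Submodule.smul_mem _ _ ?_)) (Submodule.smul_mem _ _ ?_)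
  · exact momentMap_mem_Fil h₁ e3 (by omega)
  · exact momentMap_mem_Fil h₀ e3 (by omega)
  · exact momentMap_mem_Fil h' e3 (by omega)
  · exact momentMap_mem_Fil h₀ e2 (by omega)
  · exact momentMap_mem_Fil h' e2 (by omega)
  · exact momentMap_mem_Fil h' e1 (by omega)

/-! ### Leading terms of the moments -/

theorem degree_nodePoly_sub_lt (i : ℕ) :
    (nodePoly (i + 1) - Polynomial.monomial i (2 * ((i : ℝ) + 1))).degree < i := by
  induction i using Nat.twoStepInduction with
  | zero =>
    have h : nodePoly (0 + 1) - Polynomial.monomial 0 (2 * (((0 : ℕ) : ℝ) + 1)) = 0 := by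
      rw [nodePoly, ← Polynomial.C_mul_X_pow_eq_monomial, pow_zero]
      norm_num
      rw [map_ofNat, sub_self]
    rw [h, Polynomial.degree_zero]
    exact bot_lt_iff_ne_bot.2 (by simp)
  | one =>
    have h : nodePoly (1 + 1) - Polynomial.monomial 1 (2 * (((1 : ℕ) : ℝ) + 1)) = 0 := by
      rw [nodePoly, nodePoly, nodePoly, ← Polynomial.C_mul_X_pow_eq_monomial, pow_one]
      norm_num
      rw [map_ofNat]
      ring
    rw [h, Polynomial.degree_zero]
    exact bot_lt_iff_ne_bot.2 (by simp)
  | more i h0 h1 =>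
    have h : nodePoly (i + 2 + 1) - Polynomial.monomial (i + 2) (2 * (((i + 2 : ℕ) : ℝ) + 1)) =
        2 * Polynomial.X *
            (nodePoly (i + 1 + 1) - Polynomial.monomial (i + 1) (2 * (((i + 1 : ℕ) : ℝ) + 1))) -
          Polynomial.X ^ 2 * (nodePoly (i + 1) - Polynomial.monomial i (2 * ((i : ℝ) + 1))) +
          Polynomial.X * (nodePoly (i + 1) - Polynomial.monomial i (2 * ((i : ℝ) + 1))) +
          Polynomial.monomial (i + 1) (2 * ((i : ℝ) + 1)) := by
      rw [show i + 2 + 1 = i + 1 + 2 from rfl, nodePoly]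
      simp only [← Polynomial.C_mul_X_pow_eq_monomial, map_add, map_mul,
        Polynomial.C_ofNat, map_one, map_natCast]
      push_cast
      ring
    rw [h]
    rw [Polynomial.degree_lt_iff_coeff_zero] at h0 h1 ⊢
    intro k hk
    obtain ⟨k, rfl⟩ := Nat.exists_eq_add_of_le' (show 2 ≤ k by omega)
    have e1 := h1 (k + 1) (by omega)
    have e2 := h0 k (by omega)
    have e3 := h0 (k + 1) (by omega)
    rw [Polynomial.coeff_add, Polynomial.coeff_add, Polynomial.coeff_sub, Polynomial.coeff_X_pow_mul,
      mul_assoc, Polynomial.coeff_ofNat_mul, Polynomial.coeff_X_mul, Polynomial.coeff_X_mul, e1, e2,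
      e3, Polynomial.coeff_monomial, if_neg (by omega)]
    simp

theorem powerSum_mem_Fil {P : Polynomial ℝ} {i : ℕ} (h : P.degree < i) :
    powerSum P ∈ Fil (2 * i - 1) := by
  rw [P.as_sum_support, map_sum]
  refine sum_mem fun k hk => ?_
  have hk' : k < i := by
    have := (Polynomial.le_degree_of_mem_supp k hk).trans_lt h
    exact_mod_cast this
  rw [powerSum_monomial]
  exact Submodule.smul_mem _ _ (Fil_mono (by omega) (p_mem_Fil k))

/-- Only odd power sums occur, so the first correction lies two degrees lower, and there is no term
of degree `2 r`. -/
theorem nodeSum_sub_mem_Fil (r : ℕ) :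
    nodeSum r - (2 * ((r : ℝ) + 1)) • p r ∈ Fil (2 * r - 1) := by
  rw [nodeSum, ← powerSum_monomial, ← map_sub]
  exact powerSum_mem_Fil (degree_nodePoly_sub_lt r)

/-- The sum of `p_{2i+1} p_{2j+1}` over `i + j + 1 = k`. -/
def pairSum (k : ℕ) : Gam := ∑ i ∈ range k, p i * p (k - 1 - i)

theorem pairSum_mem_Fil (k : ℕ) : pairSum k ∈ Fil (2 * k + 0) := by
  refine sum_mem fun i hi => mul_mem_Fil (p_mem_Fil _) (p_mem_Fil _) ?_
  have := mem_range.1 hi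
  omega

/-- In the exponential of `2 s ∑ p_{2k+1} z ^ (k + 1)`, a product of `q` power sums at `z ^ (r + 1)`
has degree `2 r + 2 - q`. Only `q = 1` and `q = 2` exceed the bound, with quadratic coefficient `(2
s) ^ 2 / 2 = 2`. -/
theorem expCoeff_sub_mem_Fil {s : ℝ} (hs : s * s = 1) {g : ℕ → Gam}
    (hg : ∀ r : ℕ, g r - (2 * s * ((r : ℝ) + 1)) • p r ∈ Fil (2 * r - 1)) (r : ℕ) :
    expCoeff g (r + 1) - ((2 * s) • p r + (2 : ℝ) • pairSum r) ∈ Fil (2 * r - 1) := by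
  induction r using Nat.strong_induction_on with
  | _ r ih =>
    -- Averaging the term `k` with its mirror `r - 1 - k` replaces `4 (k + 1)` by `2 (r + 1)`.
    have hsum : ∑ k ∈ range r, (4 * ((k : ℝ) + 1)) • (p k * p (r - 1 - k)) =
        (2 * ((r : ℝ) + 1)) • pairSum r := by
      have h := sum_range_reflect (fun k => (4 * ((k : ℝ) + 1)) • (p k * p (r - 1 - k))) r
      have h2 : ∑ k ∈ range r, (4 * ((k : ℝ) + 1)) • (p k * p (r - 1 - k)) +
          ∑ k ∈ range r, (4 * (((r - 1 - k : ℕ) : ℝ) + 1)) •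
            (p (r - 1 - k) * p (r - 1 - (r - 1 - k))) =
          (4 * ((r : ℝ) + 1)) • pairSum r := by
        rw [← sum_add_distrib, pairSum, smul_sum]
        refine sum_congr rfl fun k hk => ?_
        obtain ⟨j, rfl⟩ := Nat.exists_eq_add_of_lt (mem_range.1 hk)
        rw [show k + j + 1 - 1 - k = j by omega, show k + j + 1 - 1 - j = k by omega,
          mul_comm (p j), ← add_smul]
        congr 1
        push_cast
        ring
      rw [h, ← two_smul ℝ] at h2
      rw [show 4 * ((r : ℝ) + 1) = 2 * (2 * ((r : ℝ) + 1)) by ring, mul_smul] at h2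
      exact smul_right_injective Gam (two_ne_zero (α := ℝ)) h2
    have hr : ((r : ℝ) + 1) ≠ 0 := by positivity
    have key : expCoeff g (r + 1) - ((2 * s) • p r + (2 : ℝ) • pairSum r) =
        ((r : ℝ) + 1)⁻¹ • (∑ k ∈ range r, (g k * expCoeff g (r - k) -
          (4 * ((k : ℝ) + 1)) • (p k * p (r - 1 - k))) +
          (g r - (2 * s * ((r : ℝ) + 1)) • p r)) := by
      rw [expCoeff_succ, sum_range_succ, Nat.sub_self, expCoeff_zero, mul_one, sum_sub_distrib, hsum]
      have e1 : (2 * s) • p r = ((r : ℝ) + 1)⁻¹ • ((2 * s * ((r : ℝ) + 1)) • p r) := by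
        rw [smul_smul]
        congr 1
        field_simp
      have e2 : (2 : ℝ) • pairSum r = ((r : ℝ) + 1)⁻¹ • ((2 * ((r : ℝ) + 1)) • pairSum r) := by
        rw [smul_smul]
        congr 1
        field_simp
      rw [e1, e2, ← smul_add, ← smul_sub]
      congr 1
      ring
    rw [key]
    refine Submodule.smul_mem _ _ (add_mem (sum_mem fun k hk => ?_) (hg r))
    obtain ⟨j, rfl⟩ := Nat.exists_eq_add_of_lt (mem_range.1 hk)
    have hj := ih j (by omega)
    rw [show k + j + 1 - k = j + 1 by omega, show k + j + 1 - 1 - k = j by omega]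
    have hj1 : expCoeff g (j + 1) - (2 * s) • p j ∈ Fil (2 * j) := by
      have h2 : expCoeff g (j + 1) - (2 * s) • p j =
          (expCoeff g (j + 1) - ((2 * s) • p j + (2 : ℝ) • pairSum j)) + (2 : ℝ) • pairSum j := by
        ring
      rw [h2]
      exact add_mem (Fil_mono (by omega) hj)
        (Submodule.smul_mem _ _ (Fil_mono (by omega) (pairSum_mem_Fil j)))
    have hj2 : expCoeff g (j + 1) ∈ Fil (2 * j + 1) := by
      rw [← sub_add_cancel (expCoeff g (j + 1)) ((2 * s) • p j)]
      exact add_mem (Fil_mono (by omega) hj1) (Submodule.smul_mem _ _ (p_mem_Fil j))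
    have hsplit : g k * expCoeff g (j + 1) - (4 * ((k : ℝ) + 1)) • (p k * p j) =
        (g k - (2 * s * ((k : ℝ) + 1)) • p k) * expCoeff g (j + 1) +
          ((2 * s * ((k : ℝ) + 1)) • p k) * (expCoeff g (j + 1) - (2 * s) • p j) := by
      rw [sub_mul, mul_sub, smul_mul_smul_comm,
        show 2 * s * ((k : ℝ) + 1) * (2 * s) = 4 * ((k : ℝ) + 1) * (s * s) by ring, hs, mul_one]
      ring
    rw [hsplit]
    exact add_mem (mul_mem_Fil (hg k) hj2 (by push_cast; omega))
      (mul_mem_Fil (Submodule.smul_mem _ _ (p_mem_Fil k)) hj1 (by push_cast; omega))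

theorem downMoment_sub_mem_Fil (k : ℕ) :
    downMoment k - (p k + (-1 : ℝ) • pairSum k) ∈ Fil (2 * k + -1) := by
  have h := expCoeff_sub_mem_Fil (s := -1) (by norm_num) (g := fun k => -nodeSum k) (fun r => by
    have := neg_mem (nodeSum_sub_mem_Fil r)
    convert this using 1
    module) k
  have h2 : downMoment k - (p k + (-1 : ℝ) • pairSum k) = (-1 / 2 : ℝ) •
      (expCoeff (fun k => -nodeSum k) (k + 1) - ((2 * -1 : ℝ) • p k + (2 : ℝ) • pairSum k)) := by
    rw [downMoment]
    module
  rw [h2]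
  exact Submodule.smul_mem _ _ h

/-- The `α` term has degree `2 k - 1` for `k ≥ 1` and is negligible there; it survives only at `k =
0`, as the constant `α`. -/
theorem upMoment_sub_mem_Fil (α : ℝ) (k : ℕ) :
    upMoment α k - ((2 : ℝ) • p k + ((2 : ℝ) • pairSum k + if k = 0 then algebraMap ℝ Gam α else 0)) ∈
      Fil (2 * k + -1) := by
  have hmain := expCoeff_sub_mem_Fil (s := 1) (by norm_num) (g := nodeSum) (fun r => by
    have := nodeSum_sub_mem_Fil r
    rwa [mul_one])
  have h := hmain k
  rw [mul_one] at h
  rcases k with _ | k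
  · have h2 : upMoment α 0 - ((2 : ℝ) • p 0 + ((2 : ℝ) • pairSum 0 +
        if 0 = 0 then algebraMap ℝ Gam α else 0)) =
        expCoeff nodeSum (0 + 1) - ((2 : ℝ) • p 0 + (2 : ℝ) • pairSum 0) := by
      rw [upMoment, expCoeff_zero, if_pos rfl, Algebra.algebraMap_eq_smul_one]
      ring
    rw [h2]
    exact Fil_mono (by omega) h
  · have h2 : upMoment α (k + 1) - ((2 : ℝ) • p (k + 1) + ((2 : ℝ) • pairSum (k + 1) +
        if k + 1 = 0 then algebraMap ℝ Gam α else 0)) =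
        (expCoeff nodeSum (k + 1 + 1) - ((2 : ℝ) • p (k + 1) + (2 : ℝ) • pairSum (k + 1))) +
          α • ((expCoeff nodeSum (k + 1) - ((2 * 1 : ℝ) • p k + (2 : ℝ) • pairSum k)) +
            ((2 * 1 : ℝ) • p k + (2 : ℝ) • pairSum k)) := by
      rw [upMoment, if_neg (by omega), sub_add_cancel]
      ring
    rw [h2]
    refine add_mem (Fil_mono (by omega) h) (Submodule.smul_mem _ _
      (add_mem (Fil_mono (by push_cast; omega) (hmain k)) (add_mem ?_ ?_)))
    · exact Submodule.smul_mem _ _ (Fil_mono (by push_cast; omega) (p_mem_Fil k))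
    · exact Submodule.smul_mem _ _ (Fil_mono (by push_cast; omega) (pairSum_mem_Fil k))

/-! ### Expansions of the down and up operators -/

/-- The Euler operator `∑ (2i+1) p_{2i+1} ∂/∂p_{2i+1}`, truncated. -/
def euler (N : ℕ) (f : Gam) : Gam := momentMap p (firstOrder N f)

/-- The operator `∑ (2i+1)(2j+1) p_{2i+2j+1} ∂²/∂p_{2i+1}∂p_{2j+1}`, truncated. -/
def hessian (N : ℕ) (f : Gam) : Gam := momentMap p (secondOrder N f)

/-- The operator `∑ (2i+2j+3) p_{2i+1} p_{2j+1} ∂/∂p_{2i+2j+3}`, truncated. -/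
def pairing (N : ℕ) (f : Gam) : Gam := momentMap pairSum (firstOrder N f)

theorem momentMap_firstOrder (a : ℕ → Gam) (N : ℕ) (f : Gam) :
    momentMap a (firstOrder N f) = ∑ i ∈ range N, (2 * (i : ℝ) + 1) • (dp i f * a i) := by
  rw [firstOrder_apply, map_sum]
  refine sum_congr rfl fun i _ => ?_
  rw [momentMap_real_smul, momentMap_monomial]

theorem momentMap_secondOrder (a : ℕ → Gam) (N : ℕ) (f : Gam) :
    momentMap a (secondOrder N f) = ∑ i ∈ range N, ∑ j ∈ range N,
      ((2 * (i : ℝ) + 1) * (2 * (j : ℝ) + 1)) • (dp i (dp j f) * a (i + j)) := by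
  rw [secondOrder_apply, map_sum]
  refine sum_congr rfl fun i _ => ?_
  rw [map_sum]
  refine sum_congr rfl fun j _ => ?_
  rw [momentMap_real_smul, momentMap_monomial]

theorem euler_mem_Fil (N : ℕ) {m : ℤ} {f : Gam} (hf : f ∈ Fil m) : euler N f ∈ Fil m :=
  momentMap_mem_Fil p_mem_Fil (firstOrder_mem_FilT N hf) (by omega)

theorem hessian_mem_Fil (N : ℕ) {m : ℤ} {f : Gam} (hf : f ∈ Fil m) : hessian N f ∈ Fil (m - 1) :=
  momentMap_mem_Fil p_mem_Fil (secondOrder_mem_FilT N hf) (by omega)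

theorem pairing_mem_Fil (N : ℕ) {m : ℤ} {f : Gam} (hf : f ∈ Fil m) : pairing N f ∈ Fil (m - 1) :=
  momentMap_mem_Fil pairSum_mem_Fil (firstOrder_mem_FilT N hf) (by omega)

theorem pairSum_zero : pairSum 0 = 0 := by simp [pairSum]

theorem euler_mul_p_zero {N : ℕ} (hN : 0 < N) (f : Gam) :
    euler N (f * p 0) = euler N f * p 0 + f * p 0 := by
  rw [euler, firstOrder_mul_p hN, map_add, momentMap_real_smul, momentMap_monomial,
    mul_comm _ (Polynomial.C _), ← Polynomial.smul_eq_C_mul, map_smul, smul_eq_mul, euler]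
  simp [mul_comm]

theorem pairing_mul_p_zero {N : ℕ} (hN : 0 < N) (f : Gam) :
    pairing N (f * p 0) = pairing N f * p 0 := by
  rw [pairing, firstOrder_mul_p hN, map_add, momentMap_real_smul, momentMap_monomial,
    mul_comm _ (Polynomial.C _), ← Polynomial.smul_eq_C_mul, map_smul, smul_eq_mul, pairing]
  simp [mul_comm, pairSum_zero]

/-- The commutator of `hessian` with `p_1` is `2 * euler`: differentiating `p_1` uses up one of two
derivatives and adds no power of `t`. It contributes to degree zero of the composition. -/
theorem hessian_mul_p_zero {N : ℕ} (hN : 0 < N) (f : Gam) :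
    hessian N (f * p 0) = hessian N f * p 0 + (2 : ℝ) • euler N f := by
  rw [hessian, secondOrder_mul_p hN, map_add, momentMap_real_smul,
    mul_comm _ (Polynomial.C _), ← Polynomial.smul_eq_C_mul, map_smul, smul_eq_mul, hessian, euler]
  simp [mul_comm]

theorem downOp_sub_mem_Fil {N : ℕ} {m : ℤ} {f : Gam} (hf : f ∈ Fil m)
    (hdp : ∀ i, N ≤ i → dp i f = 0) :
    downOp f - (f * p 0 - euler N f + (1 / 2 : ℝ) • hessian N f + pairing N f) ∈ Fil (m - 2) := by
  have h := momentMap_taylor (s := -1) (by norm_num) (a := downMoment) (a₁ := p)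
    (a₀ := fun k => (-1 : ℝ) • pairSum k)
    (a' := fun k => downMoment k - (p k + (-1 : ℝ) • pairSum k)) (fun k => by ring) p_mem_Fil
    (fun k => Submodule.smul_mem _ _ (pairSum_mem_Fil k)) downMoment_sub_mem_Fil hf hdp
  rw [momentMap_smul, pairSum_zero] at h
  convert h using 1
  rw [euler, hessian, pairing]
  change momentMap downMoment (taylor (-1) f) - _ = _
  rw [smul_zero, mul_zero]
  module

theorem momentMap_ite (α : ℝ) {N : ℕ} (hN : 0 < N) (f : Gam) :
    momentMap (fun k => if k = 0 then algebraMap ℝ Gam α else 0) (firstOrder N f) = α • dp 0 f := by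
  rw [momentMap_firstOrder, sum_eq_single 0]
  · rw [if_pos rfl, mul_comm (dp 0 f), ← Algebra.smul_def]
    simp
  · intro i _ hi
    simp [hi]
  · intro h
    exact absurd (mem_range.2 hN) h

theorem upOp_sub_mem_Fil (α : ℝ) {N : ℕ} (hN : 0 < N) {m : ℤ} {f : Gam} (hf : f ∈ Fil m)
    (hdp : ∀ i, N ≤ i → dp i f = 0) :
    upOp α f - ((2 : ℝ) • (f * p 0) + (2 : ℝ) • euler N f + α • f + hessian N f +
      (2 : ℝ) • pairing N f + α • dp 0 f) ∈ Fil (m - 2) := by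
  have h := momentMap_taylor (s := 1) (by norm_num) (a := upMoment α) (a₁ := fun k => (2 : ℝ) • p k)
    (a₀ := fun k => (2 : ℝ) • pairSum k + if k = 0 then algebraMap ℝ Gam α else 0)
    (a' := fun k => upMoment α k -
      ((2 : ℝ) • p k + ((2 : ℝ) • pairSum k + if k = 0 then algebraMap ℝ Gam α else 0)))
    (fun k => by ring) (fun k => Submodule.smul_mem _ _ (p_mem_Fil k))
    (fun k => add_mem (Submodule.smul_mem _ _ (pairSum_mem_Fil k)) (by
      split_ifs with hk
      · rw [hk]
        exact algebraMap_mem_Fil α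
      · exact zero_mem _)) (upMoment_sub_mem_Fil α) hf hdp
  rw [momentMap_add, momentMap_ite α hN, momentMap_smul, momentMap_smul, momentMap_smul,
    pairSum_zero, if_pos rfl, smul_zero, zero_add, mul_comm f (algebraMap ℝ Gam α),
    ← Algebra.smul_def, mul_smul_comm] at h
  convert h using 1
  rw [euler, hessian, pairing]
  change momentMap (upMoment α) (taylor 1 f) - _ = _
  module

theorem exists_dp_eq_zero (f : Gam) : ∃ N, 0 < N ∧ ∀ i, N ≤ i → dp i f = 0 := by
  obtain ⟨N, hN⟩ := (finite_dp_ne_zero f).bddAbove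
  refine ⟨N + 1, by omega, fun i hi => ?_⟩
  by_contra h
  have := hN h
  omega

theorem upOp_sub_mem_Fil_self (α : ℝ) {m : ℤ} {f : Gam} (hf : f ∈ Fil m) :
    upOp α f - (2 : ℝ) • (f * p 0) ∈ Fil m := by
  obtain ⟨N, hN, hdp⟩ := exists_dp_eq_zero f
  have h := upOp_sub_mem_Fil α hN hf hdp
  have h2 : upOp α f - (2 : ℝ) • (f * p 0) =
      (upOp α f - ((2 : ℝ) • (f * p 0) + (2 : ℝ) • euler N f + α • f + hessian N f +
        (2 : ℝ) • pairing N f + α • dp 0 f)) + ((2 : ℝ) • euler N f + α • f + hessian N f +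
        (2 : ℝ) • pairing N f + α • dp 0 f) := by
    ring
  rw [h2]
  refine add_mem (Fil_mono (by omega) h) (add_mem (add_mem (add_mem (add_mem ?_ ?_) ?_) ?_) ?_)
  · exact Submodule.smul_mem _ _ (euler_mem_Fil N hf)
  · exact Submodule.smul_mem _ _ hf
  · exact Fil_mono (by omega) (hessian_mem_Fil N hf)
  · exact Submodule.smul_mem _ _ (Fil_mono (by omega) (pairing_mem_Fil N hf))
  · exact Submodule.smul_mem _ _ (Fil_mono (by omega) (dp_mem_Fil hf 0))

theorem mul_p_zero_mem_Fil {m : ℤ} {f : Gam} (hf : f ∈ Fil m) : f * p 0 ∈ Fil (m + 1) :=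
  mul_mem_Fil hf (p_mem_Fil 0) (by norm_num)

theorem upOp_mem_Fil (α : ℝ) {m : ℤ} {f : Gam} (hf : f ∈ Fil m) : upOp α f ∈ Fil (m + 1) := by
  rw [← sub_add_cancel (upOp α f) ((2 : ℝ) • (f * p 0))]
  exact add_mem (Fil_mono (by omega) (upOp_sub_mem_Fil_self α hf))
    (Submodule.smul_mem _ _ (mul_p_zero_mem_Fil hf))

theorem dp_euler {N : ℕ} {f : Gam} (hdp : ∀ i, N ≤ i → dp i f = 0) {i : ℕ} (hi : N ≤ i) :
    dp i (euler N f) = 0 := by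
  rw [euler, momentMap_firstOrder, map_sum]
  refine sum_eq_zero fun j hj => ?_
  have hij : i ≠ j := by
    have := mem_range.1 hj
    omega
  rw [map_smul, dp_mul_p, if_neg hij, dp_comm, hdp i hi, map_zero, zero_mul, add_zero, smul_zero]

/-- The expansion of the composition of the up and down operators up to terms of negative
degree. -/
theorem upOp_downOp_sub_mem_Fil (α : ℝ) {N : ℕ} (hN : 0 < N) {m : ℤ} {f : Gam} (hf : f ∈ Fil m)
    (hdp : ∀ i, N ≤ i → dp i f = 0) :
    upOp α (downOp f) - ((2 : ℝ) • (f * p 0 * p 0) + (2 + α) • (f * p 0) + α • f +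
      (2 : ℝ) • (hessian N f * p 0 + (2 : ℝ) • (pairing N f * p 0) + (1 - α / 2) • euler N f +
        (α / 2) • (dp 0 f * p 0) - euler N (euler N f))) ∈ Fil (m - 1) := by
  have hdp0 : ∀ i, N ≤ i → dp i (f * p 0) = 0 := fun i hi => by
    rw [dp_mul_p, hdp i hi, if_neg (by omega), zero_mul, add_zero]
  have hE := euler_mem_Fil N hf
  have h1 := upOp_sub_mem_Fil α hN (mul_p_zero_mem_Fil hf) hdp0
  have h2 := upOp_sub_mem_Fil α hN hE fun i hi => dp_euler hdp hi
  -- These pieces of `downOp f` already have relative degree `-1`, so only the leading term `2 p_1`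
  -- of `upOp` matters; `f * p 0` and `euler N f` need the longer expansion.
  have h3 := upOp_sub_mem_Fil_self α (add_mem (Submodule.smul_mem _ (1 / 2 : ℝ)
    (hessian_mem_Fil N hf)) (pairing_mem_Fil N hf))
  have h4 := upOp_mem_Fil α (downOp_sub_mem_Fil hf hdp)
  have h5 : hessian N (euler N f) + (2 : ℝ) • pairing N (euler N f) + α • dp 0 (euler N f) ∈
      Fil (m - 1) :=
    add_mem (add_mem (hessian_mem_Fil N hE) (Submodule.smul_mem _ _ (pairing_mem_Fil N hE)))
      (Submodule.smul_mem _ _ (Fil_mono (by omega) (dp_mem_Fil hE 0)))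
  rw [euler_mul_p_zero hN, hessian_mul_p_zero hN, pairing_mul_p_zero hN, dp_mul_p, if_pos rfl] at h1
  have hsum := add_mem (add_mem (sub_mem (sub_mem (Fil_mono (by omega) h1)
    (Fil_mono (by omega) h2)) h5) h3) (Fil_mono (by omega) h4)
  convert hsum using 1
  simp only [map_sub, map_add, map_smul, add_mul, smul_mul_assoc]
  module

/-! ### The explicit operator in terms of the expansions -/

/-- Normal ordering of the square: the first order correction combines with the multiple of `euler`
to give the linear part of `B`. -/
theorem euler_euler (N : ℕ) (f : Gam) :
    euler N (euler N f) =
      ∑ i ∈ range N, ∑ j ∈ range N, ((2 * (i : ℝ) + 1) * (2 * (j : ℝ) + 1)) •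
        (dp i (dp j f) * (p i * p j)) +
      ∑ i ∈ range N, ((2 * (i : ℝ) + 1) * (2 * (i : ℝ) + 1)) • (dp i f * p i) := by
  have h : ∀ i ∈ range N, dp i (euler N f) =
      ∑ j ∈ range N, (2 * (j : ℝ) + 1) • (dp i (dp j f) * p j) + (2 * (i : ℝ) + 1) • dp i f := by
    intro i hi
    rw [euler, momentMap_firstOrder, map_sum]
    simp only [map_smul, dp_mul_p, smul_add, sum_add_distrib]
    congr 1
    rw [sum_eq_single i]
    · rw [if_pos rfl]
    · intro j _ hj
      rw [if_neg hj.symm, smul_zero]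
    · intro h
      exact absurd hi h
  conv_lhs => rw [euler, momentMap_firstOrder]
  rw [← sum_add_distrib]
  refine sum_congr rfl fun i hi => ?_
  rw [h i hi, add_mul, smul_add, sum_mul, smul_sum, smul_mul_assoc, smul_smul]
  congr 1
  refine sum_congr rfl fun j _ => ?_
  rw [smul_mul_assoc, smul_smul, mul_assoc, mul_comm (p j)]

theorem C_mul_eq_smul (c : ℝ) (f : Gam) : MvPolynomial.C c * f = c • f :=
  MvPolynomial.C_mul'

/-- The coefficient `p_1 p_{2(i+j)+1} - p_{2i+1} p_{2j+1}` vanishes when `i` or `j` is zero, so the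
sum may be extended to all indices. -/
theorem opSum_secondOrderTerm {M : ℕ} {f : Gam} (hdp : ∀ i, M + 1 ≤ i → dp i f = 0) :
    opSum secondOrderTerm secondOrderTerm_finite f =
      ∑ i ∈ range (M + 1), ∑ j ∈ range (M + 1), ((2 * (i : ℝ) + 1) * (2 * (j : ℝ) + 1)) •
        (dp i (dp j f) * (p (i + j) * p 0 - p i * p j)) := by
  have hsupp : (Function.support fun ij => secondOrderTerm ij f) ⊆
      ((range M ×ˢ range M : Finset (ℕ × ℕ)) : Set (ℕ × ℕ)) := by
    intro ij hij
    simp only [coe_product, Set.mem_prod, mem_coe, mem_range]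
    constructor
    · by_contra h
      refine hij ?_
      simp only [secondOrderTerm, LinearMap.comp_apply]
      rw [dp_comm, hdp _ (by omega), map_zero, map_zero]
    · by_contra h
      refine hij ?_
      simp only [secondOrderTerm, LinearMap.comp_apply]
      rw [hdp _ (by omega), map_zero, map_zero]
  change ∑ᶠ ij, secondOrderTerm ij f = _
  rw [finsum_eq_sum_of_support_subset _ hsupp, sum_product, sum_range_succ']
  have hzero : ∑ j ∈ range (M + 1), ((2 * ((0 : ℕ) : ℝ) + 1) * (2 * (j : ℝ) + 1)) •
        (dp 0 (dp j f) * (p (0 + j) * p 0 - p 0 * p j)) = 0 := by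
    refine sum_eq_zero fun j _ => ?_
    rw [zero_add, mul_comm (p 0), sub_self, mul_zero, smul_zero]
  rw [hzero, add_zero]
  refine sum_congr rfl fun i _ => ?_
  rw [sum_range_succ', add_zero, sub_self, mul_zero, smul_zero, add_zero]
  refine sum_congr rfl fun j _ => ?_
  simp only [secondOrderTerm, LinearMap.comp_apply, LinearMap.mulLeft_apply]
  rw [mul_assoc, C_mul_eq_smul, show i + 1 + (j + 1) = i + j + 2 by omega]
  congr 1
  · push_cast
    ring
  · ring

theorem opSum_cubicTerm {M : ℕ} {f : Gam} (hdp : ∀ i, M + 1 ≤ i → dp i f = 0) :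
    opSum cubicTerm cubicTerm_finite f = pairing (M + 1) f * p 0 := by
  have hsupp : (Function.support fun ij => cubicTerm ij f) ⊆
      (((range M).biUnion fun k => antidiagonal k : Finset (ℕ × ℕ)) : Set (ℕ × ℕ)) := by
    intro ij hij
    rw [mem_coe, mem_biUnion]
    refine ⟨ij.1 + ij.2, ?_, mem_antidiagonal.2 rfl⟩
    rw [mem_range]
    by_contra h
    refine hij ?_
    simp only [cubicTerm, LinearMap.comp_apply]
    rw [hdp _ (by omega), map_zero]
  change ∑ᶠ ij, cubicTerm ij f = _
  rw [finsum_eq_sum_of_support_subset _ hsupp, sum_biUnion, pairing, momentMap_firstOrder,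
    sum_range_succ', pairSum_zero, mul_zero, smul_zero, add_zero, sum_mul]
  · refine sum_congr rfl fun k _ => ?_
    have hpair : pairSum (k + 1) = ∑ x ∈ antidiagonal k, p x.1 * p x.2 := by
      rw [Finset.Nat.sum_antidiagonal_eq_sum_range_succ_mk, pairSum, Nat.add_sub_cancel]
    rw [hpair, mul_sum, smul_sum, sum_mul]
    refine sum_congr rfl fun x hx => ?_
    rw [HasAntidiagonal.mem_antidiagonal] at hx
    simp only [cubicTerm, LinearMap.comp_apply, LinearMap.mulLeft_apply]
    rw [mul_assoc, C_mul_eq_smul, hx, smul_mul_assoc, ← hx]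
    congr 1
    · push_cast
      ring
    · ring
  · intro a _ b _ hab
    rw [Function.onFun, disjoint_left]
    intro x hx hx'
    rw [HasAntidiagonal.mem_antidiagonal] at hx hx'
    exact hab (hx.symm.trans hx')

/-- Extending the sum to index zero adds `(α / 2) p_1 ∂/∂p_1`, which is subtracted again. -/
theorem opSum_linearTerm (α : ℝ) {M : ℕ} {f : Gam} (hdp : ∀ i, M + 1 ≤ i → dp i f = 0) :
    opSum (linearTerm α) (linearTerm_finite α) f =
      ∑ i ∈ range (M + 1), ((2 * (i : ℝ) + 1) * (2 * (i : ℝ) + α / 2)) • (dp i f * p i) -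
        (α / 2) • (dp 0 f * p 0) := by
  have hsupp : (Function.support fun i => linearTerm α i f) ⊆ (range M : Set ℕ) := by
    intro i hi
    rw [mem_coe, mem_range]
    by_contra h
    refine hi ?_
    simp only [linearTerm, LinearMap.comp_apply]
    rw [hdp _ (by omega), map_zero]
  change ∑ᶠ i, linearTerm α i f = _
  rw [finsum_eq_sum_of_support_subset _ hsupp, sum_range_succ', Nat.cast_zero]
  have h0 : (2 * (0 : ℝ) + 1) * (2 * 0 + α / 2) = α / 2 := by ring
  rw [h0, add_sub_cancel_right]
  refine sum_congr rfl fun i _ => ?_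
  simp only [linearTerm, LinearMap.comp_apply, LinearMap.mulLeft_apply]
  rw [mul_assoc, C_mul_eq_smul, mul_comm (p _)]
  congr 1
  push_cast
  ring

theorem B_apply (α : ℝ) (f : Gam) :
    B α f = opSum secondOrderTerm secondOrderTerm_finite f +
      (2 : ℝ) • opSum cubicTerm cubicTerm_finite f -
        opSum (linearTerm α) (linearTerm_finite α) f := rfl

theorem B_eq (α : ℝ) {N : ℕ} (hN : 0 < N) {f : Gam} (hdp : ∀ i, N ≤ i → dp i f = 0) :
    B α f = hessian N f * p 0 + (2 : ℝ) • (pairing N f * p 0) + (1 - α / 2) • euler N f +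
        (α / 2) • (dp 0 f * p 0) - euler N (euler N f) := by
  obtain ⟨M, rfl⟩ := Nat.exists_eq_succ_of_ne_zero hN.ne'
  rw [Nat.succ_eq_add_one] at *
  rw [B_apply, opSum_secondOrderTerm hdp, opSum_cubicTerm hdp, opSum_linearTerm α hdp, euler_euler,
    hessian, momentMap_secondOrder]
  have h1 : ∑ i ∈ range (M + 1), ∑ j ∈ range (M + 1), ((2 * (i : ℝ) + 1) * (2 * (j : ℝ) + 1)) •
        (dp i (dp j f) * (p (i + j) * p 0 - p i * p j)) =
      (∑ i ∈ range (M + 1), ∑ j ∈ range (M + 1), ((2 * (i : ℝ) + 1) * (2 * (j : ℝ) + 1)) •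
        (dp i (dp j f) * p (i + j))) * p 0 -
      ∑ i ∈ range (M + 1), ∑ j ∈ range (M + 1), ((2 * (i : ℝ) + 1) * (2 * (j : ℝ) + 1)) •
        (dp i (dp j f) * (p i * p j)) := by
    simp only [sum_mul, ← sum_sub_distrib, smul_mul_assoc, ← smul_sub, mul_sub, mul_assoc]
  have h2 : ∑ i ∈ range (M + 1), ((2 * (i : ℝ) + 1) * (2 * (i : ℝ) + α / 2)) • (dp i f * p i) =
      ∑ i ∈ range (M + 1), ((2 * (i : ℝ) + 1) * (2 * (i : ℝ) + 1)) • (dp i f * p i) -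
        (1 - α / 2) • euler (M + 1) f := by
    rw [euler, momentMap_firstOrder, smul_sum, ← sum_sub_distrib]
    refine sum_congr rfl fun i _ => ?_
    module
  rw [h1, h2]
  module

/-! ### Elements of `Γ` are determined by their values on strict partitions -/

/-- The value at the strict partition with set of parts `S` and one more part, as a polynomial in
that part. -/
def evCons (S : Finset ℕ) : Gam →ₐ[ℝ] Polynomial ℝ :=
  MvPolynomial.aeval fun i =>
    Polynomial.C (∑ k ∈ S, (k : ℝ) ^ (2 * i + 1)) + Polynomial.X ^ (2 * i + 1)

theorem evCons_p (S : Finset ℕ) (i : ℕ) : evCons S (p i) =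
    Polynomial.C (∑ k ∈ S, (k : ℝ) ^ (2 * i + 1)) + Polynomial.X ^ (2 * i + 1) := by
  rw [evCons, p, MvPolynomial.aeval_X]

theorem eval_evCons {S : Finset ℕ} {m : ℕ} (hm : m ∉ S) (f : Gam) :
    (evCons S f).eval (m : ℝ) = ev (insert m S) f := by
  have h : (Polynomial.aeval (m : ℝ)).comp (evCons S) = ev (insert m S) := by
    apply MvPolynomial.algHom_ext
    intro i
    change Polynomial.aeval (m : ℝ) (evCons S (p i)) = ev (insert m S) (p i)
    rw [evCons_p, ev_p, sum_insert hm, Polynomial.coe_aeval_eq_eval, Polynomial.eval_add,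
      Polynomial.eval_C, Polynomial.eval_pow, Polynomial.eval_X, add_comm]
  rw [← h]
  simp [Polynomial.coe_aeval_eq_eval]

theorem coeff_zero_evCons (S : Finset ℕ) (f : Gam) : (evCons S f).coeff 0 = ev S f := by
  have h : (Polynomial.aeval (0 : ℝ)).comp (evCons S) = ev S := by
    apply MvPolynomial.algHom_ext
    intro i
    change Polynomial.aeval (0 : ℝ) (evCons S (p i)) = ev S (p i)
    rw [evCons_p, ev_p, Polynomial.coe_aeval_eq_eval, Polynomial.eval_add, Polynomial.eval_C,
      Polynomial.eval_pow, Polynomial.eval_X, zero_pow (by omega), add_zero]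
  rw [← h, Polynomial.coeff_zero_eq_eval_zero]
  simp [Polynomial.coe_aeval_eq_eval]

/-- The chain rule for an extra part `x`, truncated: the derivatives of index above `i` enter with
powers of `x` beyond `2 i` and are absorbed in `r`. -/
theorem derivative_evCons (S : Finset ℕ) (i : ℕ) (f : Gam) :
    ∃ r : Polynomial ℝ, Polynomial.derivative (evCons S f) =
      ∑ j ∈ range (i + 1), (2 * (j : Polynomial ℝ) + 1) * Polynomial.X ^ (2 * j) * evCons S (dp j f) +
        Polynomial.X ^ (2 * i + 1) * r := by
  induction f using MvPolynomial.induction_on with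
  | C a =>
    refine ⟨0, ?_⟩
    have hdp : ∀ j, dp j (MvPolynomial.C a) = 0 := fun j => MvPolynomial.pderiv_C
    simp only [hdp, map_zero, mul_zero, sum_const_zero, add_zero]
    rw [← MvPolynomial.algebraMap_eq, AlgHom.commutes, Polynomial.algebraMap_apply,
      Polynomial.derivative_C]
  | add f g hf hg =>
    obtain ⟨r, hr⟩ := hf
    obtain ⟨r', hr'⟩ := hg
    refine ⟨r + r', ?_⟩
    simp only [map_add, hr, hr', mul_add, sum_add_distrib]
    ring
  | mul_X f k hf =>
    obtain ⟨r, hr⟩ := hf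
    have hsum : ∑ j ∈ range (i + 1),
        (2 * (j : Polynomial ℝ) + 1) * Polynomial.X ^ (2 * j) * evCons S (dp j (f * p k)) =
        (∑ j ∈ range (i + 1),
          (2 * (j : Polynomial ℝ) + 1) * Polynomial.X ^ (2 * j) * evCons S (dp j f)) *
          evCons S (p k) +
        if k ∈ range (i + 1) then (2 * (k : Polynomial ℝ) + 1) * Polynomial.X ^ (2 * k) * evCons S f
          else 0 := by
      rw [← sum_ite_eq' (range (i + 1)) k fun k =>
        (2 * (k : Polynomial ℝ) + 1) * Polynomial.X ^ (2 * k) * evCons S f, sum_mul, ← sum_add_distrib]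
      refine sum_congr rfl fun j _ => ?_
      rw [dp_mul_p, map_add, map_mul]
      split_ifs
      · ring
      · rw [map_zero]
        ring
    have hder : Polynomial.derivative (evCons S (f * p k)) =
        Polynomial.derivative (evCons S f) * evCons S (p k) +
          (2 * (k : Polynomial ℝ) + 1) * Polynomial.X ^ (2 * k) * evCons S f := by
      rw [map_mul, Polynomial.derivative_mul, evCons_p, Polynomial.derivative_add,
        Polynomial.derivative_C, Polynomial.derivative_X_pow, Nat.add_sub_cancel]
      simp only [Nat.cast_add, Nat.cast_mul, Nat.cast_ofNat, Nat.cast_one, map_add, map_mul,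
        map_ofNat, map_natCast, map_one]
      ring
    change ∃ r', Polynomial.derivative (evCons S (f * p k)) =
      ∑ j ∈ range (i + 1),
        (2 * (j : Polynomial ℝ) + 1) * Polynomial.X ^ (2 * j) * evCons S (dp j (f * p k)) +
        Polynomial.X ^ (2 * i + 1) * r'
    rw [hsum, hder, hr]
    split_ifs with hk
    · exact ⟨r * evCons S (p k), by ring⟩
    · obtain ⟨l, rfl⟩ := Nat.exists_eq_add_of_le (not_lt.1 fun h => hk (mem_range.2 h))
      exact ⟨r * evCons S (p (i + 1 + l)) + (2 * ((i + 1 + l : ℕ) : Polynomial ℝ) + 1) *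
        Polynomial.X ^ (2 * l + 1) * evCons S f, by ring⟩

/-- As a polynomial in the extra part it has infinitely many integer roots. `S` may be empty, since
the extra part makes the partition nonempty. -/
theorem evCons_eq_zero {f : Gam} (hf : ∀ S : Finset ℕ, S.Nonempty → 0 ∉ S → ev S f = 0)
    {S : Finset ℕ} (h0 : 0 ∉ S) : evCons S f = 0 := by
  apply Polynomial.eq_zero_of_infinite_isRoot
  have hinf : ((fun m : ℕ => (m : ℝ)) '' {m | m ∉ insert 0 S}).Infinite :=
    Set.Infinite.image (Nat.cast_injective.injOn) (insert 0 S).finite_toSet.infinite_compl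
  refine hinf.mono ?_
  rintro _ ⟨m, hm, rfl⟩
  have hm' : m ∉ insert 0 S := hm
  rw [mem_insert, not_or] at hm'
  change (evCons S f).eval (m : ℝ) = 0
  rw [eval_evCons hm'.2]
  exact hf _ (insert_nonempty _ _) (by simp [h0, Ne.symm hm'.1])

theorem eq_C_of_dp_eq_zero {f : Gam} (h : ∀ i, dp i f = 0) :
    f = MvPolynomial.C (MvPolynomial.coeff 0 f) := by
  ext d
  rw [MvPolynomial.coeff_C]
  split_ifs with hd
  · rw [hd]
  · by_contra hne
    exact hd (Finsupp.ext fun i => (coeff_eq_zero_of_dp_eq_zero (h i) hne).symm)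

/-- By induction on the degree, it suffices that all derivatives of `f` vanish on strict partitions.
Once those of smaller index are zero, the coefficient of `x ^ (2 i)` in the derivative along an
extra part `x` isolates `(2 i + 1) ∂f/∂p_{2i+1}`. A constant is then detected at the partition
`{1}`. -/
theorem eq_zero_of_ev_eq_zero {f : Gam}
    (hf : ∀ S : Finset ℕ, S.Nonempty → 0 ∉ S → ev S f = 0) : f = 0 := by
  have key : ∀ n : ℕ, ∀ f : Gam, f ∈ Fil ((n : ℤ) - 1) →
      (∀ S : Finset ℕ, S.Nonempty → 0 ∉ S → ev S f = 0) → f = 0 := by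
    intro n
    induction n with
    | zero => exact fun f hm _ => eq_zero_of_mem_Fil (by norm_num) hm
    | succ n ih =>
      intro f hm hf
      have hdp : ∀ i, dp i f = 0 := by
        intro i
        induction i using Nat.strong_induction_on with
        | _ i hi =>
          refine ih _ (Fil_mono (by push_cast; omega) (dp_mem_Fil hm i)) fun S _ h0 => ?_
          obtain ⟨r, hr⟩ := derivative_evCons S i f
          rw [evCons_eq_zero hf h0, map_zero, sum_range_succ, sum_eq_zero (fun j hj => by
            rw [hi j (mem_range.1 hj), map_zero, mul_zero]), zero_add] at hr
          have hc := congrArg (fun P => Polynomial.coeff P (2 * i)) hr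
          have h1 : (2 * (i : Polynomial ℝ) + 1) = Polynomial.C (2 * (i : ℝ) + 1) := by
            rw [map_add, map_mul, map_ofNat, map_natCast, map_one]
          simp only [Polynomial.coeff_zero, Polynomial.coeff_add] at hc
          rw [h1, mul_assoc, Polynomial.coeff_C_mul, Polynomial.coeff_X_pow_mul', if_pos le_rfl,
            Nat.sub_self, Polynomial.coeff_X_pow_mul', if_neg (by omega), add_zero,
            coeff_zero_evCons] at hc
          exact (mul_eq_zero.1 hc.symm).resolve_left (by positivity)
      have hC := eq_C_of_dp_eq_zero hdp
      have h1 := hf {1} (by simp) (by simp)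
      rw [hC, ← MvPolynomial.algebraMap_eq, AlgHom.commutes] at h1
      change MvPolynomial.coeff 0 f = 0 at h1
      rw [hC, h1, map_zero]
  obtain ⟨m, hm⟩ := exists_mem_Fil f
  exact key (m + 1) f (Fil_mono (by push_cast; omega) hm) hf

/-! ### Degrees of operators -/

theorem opDegreeLE_iff {R : Gam →ₗ[ℝ] Gam} {r : ℤ} :
    OpDegreeLE R r ↔ ∀ (m : ℤ) (f : Gam), f ∈ Fil m → R f ∈ Fil (m + r) := by
  constructor
  · intro h m f hf
    rw [mem_Fil_iff_deg] at hf ⊢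
    refine (h f).trans ?_
    rw [WithBot.coe_add]
    gcongr
  · intro h f
    by_cases hf : f = 0
    · rw [hf, map_zero, show deg 0 = ⊥ from MvPolynomial.weightedTotalDegree'_zero wt]
      exact bot_le
    · have hne : deg f ≠ ⊥ := fun h => hf ((MvPolynomial.weightedTotalDegree'_eq_bot_iff wt f).1 h)
      obtain ⟨m, hm⟩ := WithBot.ne_bot_iff_exists.1 hne
      have h1 := mem_Fil_iff_deg.1 (h m f (mem_Fil_iff_deg.2 hm.symm.le))
      rwa [← hm, ← WithBot.coe_add]

theorem eq_zero_of_isWeightedHomogeneous_of_mem_Fil {m m' : ℤ} (hm : m' < m) {f : Gam}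
    (h : MvPolynomial.IsWeightedHomogeneous wt f m) (hf : f ∈ Fil m') : f = 0 := by
  ext d
  by_contra hd
  have h1 := h hd
  have h2 := mem_Fil.1 hf d hd
  omega

theorem isWeightedHomogeneous_dp {m m' : ℤ} {f : Gam}
    (h : MvPolynomial.IsWeightedHomogeneous wt f m) (i : ℕ) (hm : m' + (2 * (i : ℤ) + 1) = m) :
    MvPolynomial.IsWeightedHomogeneous wt (dp i f) m' :=
  h.pderiv hm

theorem isWeightedHomogeneous_p (i : ℕ) :
    MvPolynomial.IsWeightedHomogeneous wt (p i) (2 * (i : ℤ) + 1) :=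
  MvPolynomial.isWeightedHomogeneous_X ℝ wt i

theorem isWeightedHomogeneous_opSum {ι : Type} {t : ι → Gam →ₗ[ℝ] Gam}
    {ht : ∀ f, (Function.support fun i => t i f).Finite} {m : ℤ} {f : Gam}
    (h : ∀ i, MvPolynomial.IsWeightedHomogeneous wt (t i f) m) :
    MvPolynomial.IsWeightedHomogeneous wt (opSum t ht f) m :=
  finsum_induction (MvPolynomial.IsWeightedHomogeneous wt · m)
    (MvPolynomial.isWeightedHomogeneous_zero ℝ wt m) (fun _ _ h1 h2 => h1.add h2) h

theorem opHomogeneous_B (α : ℝ) : OpHomogeneous (B α) 0 := by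
  intro m f hf
  rw [add_zero, B_apply]
  refine (MvPolynomial.IsWeightedHomogeneous.add ?_ ?_).sub ?_
  · refine isWeightedHomogeneous_opSum fun ij => ?_
    have hd := isWeightedHomogeneous_dp
      (isWeightedHomogeneous_dp hf (ij.2 + 1) (sub_add_cancel _ _)) (ij.1 + 1) (sub_add_cancel _ _)
    have h1 := (isWeightedHomogeneous_p 0).mul (isWeightedHomogeneous_p (ij.1 + ij.2 + 2))
    have h2 := (isWeightedHomogeneous_p (ij.1 + 1)).mul (isWeightedHomogeneous_p (ij.2 + 1))
    have h3 : (2 * ((0 : ℕ) : ℤ) + 1) + (2 * ((ij.1 + ij.2 + 2 : ℕ) : ℤ) + 1) =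
        (2 * ((ij.1 + 1 : ℕ) : ℤ) + 1) + (2 * ((ij.2 + 1 : ℕ) : ℤ) + 1) := by
      push_cast
      ring
    rw [h3] at h1
    have h := ((h1.sub h2).C_mul ((2 * (ij.1 : ℝ) + 3) * (2 * (ij.2 : ℝ) + 3))).mul hd
    have hw : (2 * ((ij.1 + 1 : ℕ) : ℤ) + 1) + (2 * ((ij.2 + 1 : ℕ) : ℤ) + 1) +
        (m - (2 * ((ij.2 + 1 : ℕ) : ℤ) + 1) - (2 * ((ij.1 + 1 : ℕ) : ℤ) + 1)) = m := by
      push_cast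
      ring
    rw [hw] at h
    exact h
  · rw [← C_mul_eq_smul]
    refine (isWeightedHomogeneous_opSum fun ij => ?_).C_mul _
    have hd := isWeightedHomogeneous_dp hf (ij.1 + ij.2 + 1) (sub_add_cancel _ _)
    have h := ((((isWeightedHomogeneous_p 0).mul (isWeightedHomogeneous_p ij.1)).mul
      (isWeightedHomogeneous_p ij.2)).C_mul (2 * (ij.1 : ℝ) + 2 * (ij.2 : ℝ) + 3)).mul hd
    have hw : (2 * ((0 : ℕ) : ℤ) + 1) + (2 * (ij.1 : ℤ) + 1) + (2 * (ij.2 : ℤ) + 1) +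
        (m - (2 * ((ij.1 + ij.2 + 1 : ℕ) : ℤ) + 1)) = m := by
      push_cast
      ring
    rw [hw] at h
    exact h
  · refine isWeightedHomogeneous_opSum fun i => ?_
    have hd := isWeightedHomogeneous_dp hf (i + 1) (sub_add_cancel _ _)
    have h := ((isWeightedHomogeneous_p (i + 1)).C_mul
      ((2 * (i : ℝ) + 3) * (2 * (i : ℝ) + 2 + α / 2))).mul hd
    have hw : (2 * ((i + 1 : ℕ) : ℤ) + 1) + (m - (2 * ((i + 1 : ℕ) : ℤ) + 1)) = m := by
      push_cast
      ring
    rw [hw] at h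
    exact h

theorem dp_succ_p_zero_mul (i : ℕ) (f : Gam) : dp (i + 1) (p 0 * f) = p 0 * dp (i + 1) f := by
  rw [dp_mul, dp_p, if_neg (Nat.succ_ne_zero i), zero_mul, zero_add]

theorem opSum_commute {ι : Type} {t : ι → Gam →ₗ[ℝ] Gam}
    {ht : ∀ f, (Function.support fun i => t i f).Finite} {f g : Gam}
    (h : ∀ i, t i (g * f) = g * t i f) : opSum t ht (g * f) = g * opSum t ht f := by
  change ∑ᶠ i, t i (g * f) = g * ∑ᶠ i, t i f
  rw [mul_finsum]
  exact finsum_congr h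

/-- The operator `B` commutes with multiplication by `p_1`. -/
theorem B_p_zero_mul (α : ℝ) (f : Gam) : B α (p 0 * f) = p 0 * B α f := by
  rw [B_apply, B_apply, opSum_commute, opSum_commute, opSum_commute, mul_sub, mul_add,
    mul_smul_comm]
  · intro i
    simp only [linearTerm, LinearMap.comp_apply, LinearMap.mulLeft_apply, dp_succ_p_zero_mul]
    ring
  · intro ij
    simp only [cubicTerm, LinearMap.comp_apply, LinearMap.mulLeft_apply, dp_succ_p_zero_mul]
    ring
  · intro ij
    simp only [secondOrderTerm, LinearMap.comp_apply, LinearMap.mulLeft_apply, dp_succ_p_zero_mul]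
    ring

theorem B_mem_Fil (α : ℝ) {m : ℤ} {f : Gam} (hf : f ∈ Fil m) : B α f ∈ Fil m := by
  obtain ⟨N, hN, hdp⟩ := exists_dp_eq_zero f
  have hE := euler_mem_Fil N hf
  rw [B_eq α hN hdp]
  refine sub_mem (add_mem (add_mem (add_mem ?_ (Submodule.smul_mem _ _ ?_))
    (Submodule.smul_mem _ _ hE)) (Submodule.smul_mem _ _ ?_)) (euler_mem_Fil N hE)
  · exact Fil_mono (by omega) (mul_p_zero_mem_Fil (hessian_mem_Fil N hf))
  · exact Fil_mono (by omega) (mul_p_zero_mem_Fil (pairing_mem_Fil N hf))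
  · exact Fil_mono (by omega) (mul_p_zero_mem_Fil (dp_mem_Fil hf 0))

/-- A witness that `B` is nonzero: `B p_3 = 6 p_1 ^ 3 - 3 (2 + α / 2) p_3`, and all odd power sums
equal one at `{1}`. -/
theorem ev_B_p_one (α : ℝ) : ev {1} (B α (p 1)) = -(3 / 2) * α := by
  have hdp : ∀ i, 2 ≤ i → dp i (p 1) = 0 := fun i hi => by rw [dp_p, if_neg (by omega)]
  have h1 : euler 2 (p 1) = (3 : ℝ) • p 1 := by
    rw [euler, momentMap_firstOrder]
    simp [dp_p]
    norm_num
  have h2 : pairing 2 (p 1) = (3 : ℝ) • (p 0 * p 0) := by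
    rw [pairing, momentMap_firstOrder]
    simp [dp_p, pairSum]
    norm_num
  have h3 : hessian 2 (p 1) = 0 := by
    rw [hessian, momentMap_secondOrder]
    refine sum_eq_zero fun i _ => sum_eq_zero fun j _ => ?_
    rw [dp_p, apply_ite (dp i), map_zero, show dp i 1 = 0 from MvPolynomial.pderiv_one, ite_self,
      zero_mul, smul_zero]
  have h4 : euler 2 (euler 2 (p 1)) = (9 : ℝ) • p 1 := by
    rw [h1, euler, map_smul, momentMap_real_smul]
    change (3 : ℝ) • euler 2 (p 1) = _
    rw [h1, smul_smul]
    norm_num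
  have h5 : ∀ i, ev {1} (p i) = 1 := fun i => by simp [ev_p]
  rw [B_eq α two_pos hdp, h4, h1, h2, h3, dp_p]
  simp only [map_add, map_sub, map_smul, map_mul, h5, if_neg zero_ne_one, zero_mul, map_zero,
    smul_eq_mul, smul_zero]
  ring

/-! ### The operator representing the up/down chains -/

/-- The operator on `Γ` representing the generators `T_n - 1` of the up/down chains. -/
def generator (α : ℝ) : Gam →ₗ[ℝ] Gam :=
  (1 / 2 : ℝ) • (upOp α ∘ₗ downOp) -
    -- The multiplier is `(p_1 + α / 2) (p_1 + 1)`, whose value on partitions of `n` is the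
    -- denominator in the representation.
    LinearMap.mulRight ℝ (p 0 * p 0 + (1 + α / 2) • p 0 + (α / 2) • (1 : Gam))

theorem generator_apply (α : ℝ) (f : Gam) :
    generator α f = (1 / 2 : ℝ) • upOp α (downOp f) -
      (f * p 0 * p 0 + (1 + α / 2) • (f * p 0) + (α / 2) • f) := by
  simp only [generator, LinearMap.sub_apply, LinearMap.smul_apply, LinearMap.comp_apply,
    LinearMap.mulRight_apply, mul_add, mul_smul_comm, mul_one, mul_assoc]

theorem generator_sub_B_mem_Fil (α : ℝ) {m : ℤ} {f : Gam} (hf : f ∈ Fil m) :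
    generator α f - B α f ∈ Fil (m - 1) := by
  obtain ⟨N, hN, hdp⟩ := exists_dp_eq_zero f
  have h := Submodule.smul_mem _ (1 / 2 : ℝ) (upOp_downOp_sub_mem_Fil α hN hf hdp)
  rw [← B_eq α hN hdp] at h
  rw [generator_apply]
  convert h using 1
  module

theorem opDegreeLE_generator_sub_B (α : ℝ) : OpDegreeLE (generator α - B α) (-1) :=
  opDegreeLE_iff.2 fun _ _ hf => generator_sub_B_mem_Fil α hf

theorem representsUpDown_generator {α : ℝ} (hα : 0 < α) : RepresentsUpDown α (generator α) := by
  intro n _ f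
  ext lam
  have hp : ev (partSet lam) (p 0) = n := by
    rw [ev_p, ← sum_partSet_cast lam]
    simp
  have h1 : (n : ℝ) + α / 2 ≠ 0 := by positivity
  have h2 : (n : ℝ) + 1 ≠ 0 := by positivity
  have h3 : 2 * (n : ℝ) + α ≠ 0 := by positivity
  rw [Pi.sub_apply, Pi.smul_apply, T_restrict hα, restrict_apply, restrict_apply, generator_apply]
  simp only [map_sub, map_add, map_smul, map_mul, hp, smul_eq_mul]
  rw [show (n : ℝ) + α / 2 = (2 * n + α) / 2 by ring]
  field_simp
  ring

/-- At each nonempty strict partition the scalar in the representation is nonzero, so both images of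
`f` take the same value there; linearity of the maps plays no role. -/
theorem eq_of_representsUpDown {α : ℝ} (hα : 0 < α) {R R' : Gam → Gam}
    (hR : RepresentsUpDown α R) (hR' : RepresentsUpDown α R') : R = R' := by
  funext f
  rw [← sub_eq_zero]
  refine eq_zero_of_ev_eq_zero fun S hS h0 => ?_
  obtain ⟨lam, hlam⟩ := exists_partSet_eq h0 rfl
  have hn : 1 ≤ ∑ k ∈ S, k := by
    obtain ⟨k, hk⟩ := hS
    have h1 : k ≤ ∑ k ∈ S, k := single_le_sum (f := fun k => k) (fun _ _ => Nat.zero_le _) hk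
    have h2 : k ≠ 0 := fun h => h0 (h ▸ hk)
    omega
  have h := congrFun ((hR _ hn f).symm.trans (hR' _ hn f)) lam
  have hpos : (1 : ℝ) / ((((∑ k ∈ S, k : ℕ) : ℝ) + α / 2) * (((∑ k ∈ S, k : ℕ) : ℝ) + 1)) ≠ 0 := by
    positivity
  rw [Pi.smul_apply, Pi.smul_apply, restrict_apply, restrict_apply, hlam, smul_eq_mul,
    smul_eq_mul] at h
  rw [map_sub, mul_left_cancel₀ hpos h, sub_self]

theorem opHasDegree_generator {α : ℝ} (hα : 0 < α) : OpHasDegree (generator α) 0 := by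
  refine ⟨opDegreeLE_iff.2 fun m f hf => ?_, fun s hs => ?_⟩
  · rw [add_zero, ← sub_add_cancel (generator α f) (B α f)]
    exact add_mem (Fil_mono (by omega) (generator_sub_B_mem_Fil α hf)) (B_mem_Fil α hf)
  -- A negative degree would force `B p_3` to have degree at most two; being homogeneous of degree
  -- three it would vanish, against its value at `{1}`.
  · by_contra hneg
    have h1 := opDegreeLE_iff.1 hs _ _ (p_mem_Fil 1)
    have h2 := generator_sub_B_mem_Fil α (p_mem_Fil 1)
    have h3 : B α (p 1) ∈ Fil (2 * ((1 : ℕ) : ℤ) + 1 - 1) := by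
      rw [← sub_sub_cancel (generator α (p 1)) (B α (p 1))]
      exact sub_mem (Fil_mono (by omega) h1) h2
    have h4 := eq_zero_of_isWeightedHomogeneous_of_mem_Fil (by omega)
      (opHomogeneous_B α _ _ (isWeightedHomogeneous_p 1)) h3
    have h5 := ev_B_p_one α
    rw [h4, map_zero] at h5
    linarith

/-- The difference of two such components preserves the degree of each monomial and also lowers it,
hence kills every monomial. -/
theorem eq_B_of_isZeroDegreeComponent {α : ℝ} {S : Gam →ₗ[ℝ] Gam}
    (hS : IsZeroDegreeComponent (generator α) S) : S = B α := by
  apply LinearMap.ext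
  intro f
  rw [f.as_sum, map_sum, map_sum]
  refine sum_congr rfl fun d _ => ?_
  have hd : MvPolynomial.IsWeightedHomogeneous wt
      (MvPolynomial.monomial d (MvPolynomial.coeff d f)) (Finsupp.weight wt d) :=
    MvPolynomial.isWeightedHomogeneous_monomial wt d _ rfl
  have hF := mem_Fil_of_isWeightedHomogeneous hd
  have h1 := opDegreeLE_iff.1 hS.2 _ _ hF
  have h2 := opDegreeLE_iff.1 (opDegreeLE_generator_sub_B α) _ _ hF
  have h3 := sub_mem h2 h1
  rw [LinearMap.sub_apply, LinearMap.sub_apply, sub_sub_sub_cancel_left] at h3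
  exact sub_eq_zero.1 (eq_zero_of_isWeightedHomogeneous_of_mem_Fil (by omega)
    ((hS.1 _ _ hd).sub (opHomogeneous_B α _ _ hd)) h3)

end

end SchurGraph

theorem theorem5p1 (α : ℝ) (hα : 0 < α) :
    ∃ Bt : SchurGraph.Gam →ₗ[ℝ] SchurGraph.Gam,
      SchurGraph.RepresentsUpDown α Bt ∧
      (∀ R : SchurGraph.Gam → SchurGraph.Gam, SchurGraph.RepresentsUpDown α R → R = Bt) ∧
      SchurGraph.OpHasDegree Bt 0 ∧
      SchurGraph.IsZeroDegreeComponent Bt (SchurGraph.B α) ∧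
      (∀ S : SchurGraph.Gam →ₗ[ℝ] SchurGraph.Gam,
        SchurGraph.IsZeroDegreeComponent Bt S → S = SchurGraph.B α) ∧
      (∀ f : SchurGraph.Gam,
        SchurGraph.B α (SchurGraph.p 0 * f) = SchurGraph.p 0 * SchurGraph.B α f) := by
  open SchurGraph in
  exact ⟨generator α, representsUpDown_generator hα,
    fun R hR => eq_of_representsUpDown hα hR (representsUpDown_generator hα),
    opHasDegree_generator hα, ⟨opHomogeneous_B α, opDegreeLE_generator_sub_B α⟩,
    fun S hS => eq_B_of_isZeroDegreeComponent hS, B_p_zero_mul α⟩
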